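/- Let $\mathbf K$, with strong-submodel relation $\leq_{\mathbf K}$, be an abstract elementary class with Löwenheim–Skolem–Tarski number $\mathrm{LST}(\mathbf K)$. For a cardinal $\mu$ let $\mathbf K_\mu$ be the class of models in $\mathbf K$ of cardinality $\mu$, and write $A <_{\mathbf K} B$ for $A\leq_{\mathbf K} B$ and $A\neq B$. Embedding means $\mathbf K$-embedding, $S(A)$ is the set of Galois types $\mathrm{tp}(b/A;B)$ over $A$ (with $A\leq_{\mathbf K}B$ and $b\in B$), and $S^{na}(A)\subseteq S(A)$ is the set of non-algebraic ones (those with $b\in B\setminus A$). *Amalgamation in $\mathbf K_\mu$*: for all $A,B,C\in\mathbf K_\mu$ with $A\leq_{\mathbf K}B$ and $A\leq_{\mathbf K}C$ there are $D\in\mathbf K_\mu$ and embeddings $f_B:B\to D$, $f_C:C\to D$ with $f_B\restriction A=f_C\restriction A$. *No maximal model in $\mathbf K_\mu$*: every $A\in\mathbf K_\mu$ has some $B\in\mathbf K_\mu$ with $A<_{\mathbf K}B$. *Stability in $\mathbf K_\mu$*: $|S^{na}(M)|\le\mu$ for every $M\in\mathbf K_\mu$. Fix $\lambda\geq\mathrm{LST}(\mathbf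 K)$. For $A\leq_{\mathbf K}B$ in $\mathbf K_\lambda$, a type $p\in S^{na}(B)$ *does not $\lambda$-split over $A$* if $f(p\restriction M_1)=p\restriction M_2$ for all $M_1,M_2\in\mathbf K_\lambda$ with $A\leq_{\mathbf K}M_i\leq_{\mathbf K}B$ $(i=1,2)$ and every isomorphism $f:M_1\cong M_2$ with $f\restriction A=\mathrm{id}_A$. Let $\mathfrak s_{ns}$ be the pre-$\lambda$-frame whose non-forking relation is non-$\lambda$-splitting and whose basic types are all non-algebraic types over models in $\mathbf K_\lambda$. - *Transitivity* of $\mathfrak s_{ns}$: for $A\leq_{\mathbf K}B\leq_{\mathbf K}C$ in $\mathbf K_\lambda$ and $p\in S^{na}(C)$, if $p$ does not $\lambda$-split over $B$ and $p\restriction B$ is non-algebraic and does not $\lambda$-split over $A$, then $p$ does not $\lambda$-split over $A$. - *Continuity* of $\mathfrak s_{ns}$: for every nonzero limit ordinal $\delta<\lambda^+$, every $\leq_{\mathbf K}$-increasing continuous sequence $\langle A_\alpha\mid\alpha\leq\delta\rangle$ of models in $\mathbf K_\lambda$ and every $p\in S(A_\delta)$, if for every $\alpha<\delta$ the type $p\restriction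 A_\alpha$ is non-algebraic and does not $\lambda$-split over $A_0$, then $p$ is non-algebraic and does not $\lambda$-split over $A_0$. A *basic triple* is $(A,B,b)$ with $A<_{\mathbf K}B$ in $\mathbf K_\lambda$ and $b\in B\setminus A$. It is a *uniqueness triple* of $\mathfrak s_{ns}$ if there do not exist $C,D,F\in\mathbf K_\lambda$ with $A<_{\mathbf K}C\leq_{\mathbf K}D$ and $C\leq_{\mathbf K}F$ and embeddings $f:B\to D$, $g:B\to F$ with $f\restriction A=g\restriction A=\mathrm{id}_A$ such that - $\mathrm{tp}(f(b)/C;D)=\mathrm{tp}(g(b)/C;F)$, and this type is non-algebraic and does not $\lambda$-split over $A$; and - the amalgamations $(f,\mathrm{id}_C,D)$ and $(g,\mathrm{id}_C,F)$ are not equivalent, i.e. there are no $G\in\mathbf K$ and embeddings $h:D\to G$, $k:F\to G$ with $h\circ f=k\circ g$ and $h\restriction C=k\restriction C$. **Statement.** Suppose that: 1. $\lambda\geq\mathrm{LST}(\mathbf K)$, $\mathbf K_\lambda\neq\emptyset$, and $\diamondsuit(\lambda^+)$ holds; 2. $\mathfrak s_{ns}$ satisfies transitivity and continuity; 3. $\mathbf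 K_\lambda$ satisfies amalgamation and has no maximal model; 4. $\mathbf K_{\lambda^+}$ satisfies amalgamation and stability. Then the uniqueness triples of $\mathfrak s_{ns}$ are dense with respect to non-splitting: for every basic triple $(A,B,b)$ there is a uniqueness triple $(C,D,b)$ of $\mathfrak s_{ns}$ with $A\leq_{\mathbf K}C$ and $B\leq_{\mathbf K}D$ such that $\mathrm{tp}(b/C;D)$ does not $\lambda$-split over $A$. -/

import Mathlib

open scoped FirstOrder Cardinal

universe u

namespace AECFrame

/-! ### Structures whose universe is a set -/

/-- A `τ`-model: an `L`-structure whose universe is a set, i.e. a small collection of elements of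
the universe of sets `ZFSet.{u}`.  Taking the elements from one universe of sets makes
"is a submodel of", "union of a chain" and "the same element `b`" literal notions. -/
structure Model (L : FirstOrder.Language.{u, u}) : Type (u + 1) where
  carrier : Set ZFSet.{u}
  small : Small.{u} carrier
  str : L.Structure carrier

variable {L : FirstOrder.Language.{u, u}}

instance : CoeSort (Model L) (Type (u + 1)) := ⟨fun A => A.carrier⟩

instance (A : Model L) : L.Structure A.carrier := A.str

/-- `A ⊆ B`: the universe of `A` is contained in that of `B`, and the symbols are interpreted in
`A` as the restrictions of their interpretations in `B`. -/
structure Model.IsSubmodel (A B : Model L) : Prop where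
  subset : A.carrier ⊆ B.carrier
  map_fun : ∀ (n : ℕ) (f : L.Functions n) (x : Fin n → A),
    Set.inclusion subset (FirstOrder.Language.Structure.funMap f x) =
      FirstOrder.Language.Structure.funMap f (fun i => Set.inclusion subset (x i))
  map_rel : ∀ (n : ℕ) (r : L.Relations n) (x : Fin n → A),
    FirstOrder.Language.Structure.RelMap r (fun i => Set.inclusion subset (x i)) ↔
      FirstOrder.Language.Structure.RelMap r x

/-- The inclusion map of a submodel. -/
def Model.IsSubmodel.incl {A B : Model L} (h : A.IsSubmodel B) : A ↪[L] B where
  toFun := Set.inclusion h.subset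
  inj' := Set.inclusion_injective h.subset
  map_fun' := fun {n} f x => h.map_fun n f x
  map_rel' := fun {n} r x => h.map_rel n r x

/-- `U = ⋃_{α < δ} A α`, as `L`-structures. -/
def Model.IsUnion (U : Model L) (A : Ordinal.{u} → Model L) (δ : Ordinal.{u}) : Prop :=
  (∀ α < δ, (A α).IsSubmodel U) ∧ U.carrier = {x | ∃ α < δ, x ∈ (A α).carrier}

/-- `⟨A α ∣ α ≤ δ⟩` is increasing with respect to the relation `le`, and continuous. -/
structure IsContChain (le : Model L → Model L → Prop) (A : Ordinal.{u} → Model L)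
    (δ : Ordinal.{u}) : Prop where
  mono : ∀ α β, α ≤ β → β ≤ δ → le (A α) (A β)
  cont : ∀ γ ≤ δ, Order.IsSuccLimit γ → (A γ).IsUnion A γ

/-! ### Abstract elementary classes -/

/-- The Löwenheim–Skolem–Tarski property of the cardinal `κ` for the class `mem` with the
strong-submodel relation `le`. -/
def LSTProperty (mem : Model L → Prop) (le : Model L → Model L → Prop) (κ : Cardinal.{u}) : Prop :=
  ℵ₀ ≤ κ ∧ L.card ≤ κ ∧
    ∀ (N : Model L), mem N → ∀ Z : Set ZFSet.{u}, Z ⊆ N.carrier →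
      ∃ M : Model L, le M N ∧ Z ⊆ M.carrier ∧
        #M.carrier ≤ max (Cardinal.lift.{u + 1, u} κ) #Z

variable (L) in
/-- An abstract elementary class in the vocabulary `L`. -/
structure AEC : Type (u + 1) where
  /-- the class of models -/
  mem : Model L → Prop
  /-- the strong-submodel relation `≤_K` -/
  le : Model L → Model L → Prop
  le_mem : ∀ {A B}, le A B → mem A ∧ mem B
  /-- closure of the class under isomorphisms -/
  mem_iso : ∀ {B C : Model L} (_ : B ≃[L] C), mem B → mem C
  /-- If `A ≤_K B` and `φ : B ≅ C`, then `φ[A] ≤_K C`.  Here `A'` with the isomorphism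
  `ψ = φ ↾ A : A ≅ A'` is the model `φ[A]`. -/
  le_iso : ∀ {A A' B C : Model L} (φ : B ≃[L] C) (ψ : A ≃[L] A'), le A B →
    (∀ (a : A) (b : B), (a : ZFSet.{u}) = b → (ψ a : ZFSet.{u}) = φ b) → le A' C
  refl : ∀ {A}, mem A → le A A
  trans : ∀ {A B C}, le A B → le B C → le A C
  isSubmodel : ∀ {A B}, le A B → A.IsSubmodel B
  /-- unions of increasing chains of nonzero length -/
  union : ∀ (δ : Ordinal.{u}) (A : Ordinal.{u} → Model L) (U : Model L), 0 < δ →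
    (∀ α β, α ≤ β → β < δ → le (A α) (A β)) → U.IsUnion A δ → mem U ∧ ∀ β < δ, le (A β) U
  smooth : ∀ (δ : Ordinal.{u}) (A : Ordinal.{u} → Model L) (N : Model L), Order.IsSuccLimit δ →
    IsContChain le A δ → (∀ α < δ, le (A α) N) → le (A δ) N
  coherence : ∀ {A B C}, A.IsSubmodel B → B.IsSubmodel C → le A C → le B C → le A B
  exists_lst : ∃ κ : Cardinal.{u}, LSTProperty mem le κ

namespace AEC

variable (K : AEC L)

/-- The Löwenheim–Skolem–Tarski number of `K`. -/
noncomputable def LST : Cardinal.{u} := sInf {κ | LSTProperty K.mem K.le κ}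

/-- `A <_K B`. -/
def lt (A B : Model L) : Prop := K.le A B ∧ A ≠ B

/-- `A ∈ K_μ`: the model `A` is in `K` and its universe has cardinality `μ`. -/
def memCard (μ : Cardinal.{u}) (A : Model L) : Prop :=
  K.mem A ∧ #A.carrier = Cardinal.lift.{u + 1, u} μ

/-- A `K`-embedding of `A` into `B`: an isomorphism of `A` onto a strong submodel of `B`. -/
structure Emb (A B : Model L) where
  toEmbedding : A ↪[L] B
  strong : ∃ A' : Model L, K.le A' B ∧
    A'.carrier = {y | ∃ a : A, (toEmbedding a : ZFSet.{u}) = y}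

instance (A B : Model L) : CoeFun (K.Emb A B) (fun _ => A → B) := ⟨fun f => f.toEmbedding⟩

variable {K} in
/-- The identity map `id_A : A → B` for `A ≤_K B`. -/
def incl {A B : Model L} (h : K.le A B) : K.Emb A B where
  toEmbedding := (K.isSubmodel h).incl
  strong := ⟨A, h, by
    ext y
    exact ⟨fun hy => ⟨⟨y, hy⟩, rfl⟩, by rintro ⟨a, rfl⟩; exact a.2⟩⟩

/-- `(f_B, f_C, D)` is an amalgamation of `B` and `C` over `(A, g_B, g_C)`. -/
def IsAmalgamation {A B C D : Model L} (gB : K.Emb A B) (gC : K.Emb A C)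
    (fB : K.Emb B D) (fC : K.Emb C D) : Prop :=
  ∀ a : A, fB (gB a) = fC (gC a)

/-- The amalgamation property of `K_μ`. -/
def Amalgamation (μ : Cardinal.{u}) : Prop :=
  ∀ A B C : Model L, K.memCard μ A → K.memCard μ B → K.memCard μ C →
    ∀ (hB : K.le A B) (hC : K.le A C), ∃ (D : Model L) (fB : K.Emb B D) (fC : K.Emb C D),
      K.memCard μ D ∧ K.IsAmalgamation (incl hB) (incl hC) fB fC

/-- `K_μ` has no maximal model. -/
def NoMaximalModel (μ : Cardinal.{u}) : Prop :=
  ∀ A : Model L, K.memCard μ A → ∃ B : Model L, K.memCard μ B ∧ K.lt A B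

/-- The relation `E` between two amalgamations `(f_B^D, f_C^D, D)` and `(f_B^F, f_C^F, F)` of `B`
and `C`. -/
def AmalgEquiv {B C D F : Model L} (fBD : K.Emb B D) (fCD : K.Emb C D)
    (fBF : K.Emb B F) (fCF : K.Emb C F) : Prop :=
  ∃ (G : Model L) (fD : K.Emb D G) (fF : K.Emb F G),
    (∀ b : B, fD (fBD b) = fF (fBF b)) ∧ (∀ c : C, fD (fCD c) = fF (fCF c))

/-! ### Galois types -/

/-- A triple `(A, B, b)` with `A ≤_K B` and `b ∈ B`, for a fixed `A`. -/
structure Pointed (A : Model L) : Type (u + 1) where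
  model : Model L
  le : K.le A model
  pt : model

/-- Atomic equivalence of `(A, B, b)` and `(A, C, c)`: there is an amalgamation `(f, g, D)` of `B`
and `C` over `A` with `f b = g c`. -/
def Pointed.Rel {A : Model L} (P Q : K.Pointed A) : Prop :=
  ∃ (D : Model L) (f : K.Emb P.model D) (g : K.Emb Q.model D),
    K.IsAmalgamation (incl P.le) (incl Q.le) f g ∧ f P.pt = g Q.pt

/-- `S(A)`: the Galois types over `A`, i.e. the classes of the equivalence relation generated by
atomic equivalence. -/
def GType (A : Model L) : Type (u + 1) := Quot (Pointed.Rel K (A := A))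

variable {K}

/-- `tp(b/A; B)`. -/
def tp {A B : Model L} (h : K.le A B) (b : B) : K.GType A := Quot.mk _ ⟨B, h, b⟩

/-- `p ↾ A` for `p ∈ S(B)` and `A ≤_K B`; it sends `tp(c/B; C)` to `tp(c/A; C)`. -/
def GType.restrict {A B : Model L} (h : K.le A B) (p : K.GType B) : K.GType A :=
  Quot.map (fun P => ⟨P.model, K.trans h P.le, P.pt⟩)
    (by
      rintro P Q ⟨D, f, g, hfg, hpt⟩
      exact ⟨D, f, g, fun a => hfg (incl h a), hpt⟩) p

variable (K)

/-- `S^na(A)`: the non-algebraic types over `A`. -/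
def nonalgebraic (A : Model L) : Set (K.GType A) :=
  {p | ∃ (B : Model L) (h : K.le A B) (b : B), (b : ZFSet.{u}) ∉ A.carrier ∧ p = tp h b}

/-- Stability of `K_μ`: `|S^na(M)| ≤ μ` for every `M ∈ K_μ`. -/
def Stable (μ : Cardinal.{u}) : Prop :=
  ∀ M : Model L, K.memCard μ M → #(K.nonalgebraic M) ≤ Cardinal.lift.{u + 1, u} μ

variable {K} in
/-- `f(p) = q` for an isomorphism `f : M₁ ≅ M₂` and types `p ∈ S(M₁)`, `q ∈ S(M₂)`: there are
`N₁ ≥_K M₁`, `b ∈ N₁` and an isomorphism `φ : N₁ ≅ N₂` extending `f`, with `p = tp(b/M₁; N₁)` and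
`q = tp(φ(b)/M₂; N₂)`. -/
def GType.MapsTo {M₁ M₂ : Model L} (f : M₁ ≃[L] M₂) (p : K.GType M₁) (q : K.GType M₂) : Prop :=
  ∃ (N₁ N₂ : Model L) (h₁ : K.le M₁ N₁) (h₂ : K.le M₂ N₂) (φ : N₁ ≃[L] N₂) (b : N₁),
    (∀ x : M₁, φ (incl h₁ x) = incl h₂ (f x)) ∧ p = tp h₁ b ∧ q = tp h₂ (φ b)

variable {K} in
/-- The type `p ∈ S(B)` does not `μ`-split over `A` (used for `A ≤_K B` and `p` non-algebraic). -/
def GType.DoesNotSplit (μ : Cardinal.{u}) (A : Model L) {B : Model L} (p : K.GType B) : Prop :=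
  ∀ M₁ M₂ : Model L, K.memCard μ M₁ → K.memCard μ M₂ → ∀ (f : M₁ ≃[L] M₂)
    (hA₁ : K.le A M₁) (h₁ : K.le M₁ B) (hA₂ : K.le A M₂) (h₂ : K.le M₂ B),
    (∀ a : A, f (incl hA₁ a) = incl hA₂ a) → GType.MapsTo f (p.restrict h₁) (p.restrict h₂)

end AEC

/-! ### Frames -/

/-- The data of a pre-`μ`-frame on `K`: a relation on quadruples `(A, B, c, C)` and a set of basic
types over each model.  Only the non-splitting frame defined below is used. -/
structure FrameData (K : AEC L) where
  nf : ∀ (_ _ C : Model L), C → Prop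
  basic : ∀ A : Model L, Set (K.GType A)

namespace FrameData

variable {K : AEC L} (s : FrameData K) (μ : Cardinal.{u})

/-- The type `p ∈ S(B)` does not fork over `A`. -/
def NonForking (A : Model L) {B : Model L} (p : K.GType B) : Prop :=
  ∃ (C : Model L) (h : K.le B C) (c : C), p = AEC.tp h c ∧ s.nf A B C c

/-- Transitivity of a pre-`μ`-frame. -/
def Transitivity : Prop :=
  ∀ A B C : Model L, K.memCard μ A → K.memCard μ B → K.memCard μ C →
    ∀ (_ : K.le A B) (hBC : K.le B C) (p : K.GType C),
      s.NonForking B p → s.NonForking A (p.restrict hBC) → s.NonForking A p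

/-- Continuity of a pre-`μ`-frame. -/
def Continuity : Prop :=
  ∀ δ : Ordinal.{u}, Order.IsSuccLimit δ → δ < (Order.succ μ).ord →
    ∀ (A : Ordinal.{u} → Model L) (hA : IsContChain K.le A δ), (∀ α ≤ δ, K.memCard μ (A α)) →
      ∀ p : K.GType (A δ),
        (∀ (α : Ordinal.{u}) (hα : α < δ),
          s.NonForking (A 0) (p.restrict (hA.mono α δ hα.le le_rfl))) →
        p ∈ s.basic (A δ) ∧ s.NonForking (A 0) p

/-- `(A, B, b) ∈ K^{3,bs}`: basic triples. -/
def IsBasicTriple (A B : Model L) (b : ZFSet.{u}) : Prop :=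
  K.memCard μ A ∧ K.memCard μ B ∧ A ≠ B ∧ b ∉ A.carrier ∧
    ∃ (h : K.le A B) (hb : b ∈ B.carrier), AEC.tp h ⟨b, hb⟩ ∈ s.basic A

/-- `(A, B, b) ≤_bs (C, D, b)`, for basic triples with the same element `b`. -/
def LeBasic (A B C D : Model L) (b : ZFSet.{u}) : Prop :=
  K.le A C ∧ K.le B D ∧
    ∃ (h : K.le C D) (hb : b ∈ D.carrier), s.NonForking A (AEC.tp h ⟨b, hb⟩)

/-- `C` witnesses the non-uniqueness of the basic triple `(A, B, b)`. -/
def WitnessesNonUniqueness (A B : Model L) (b : ZFSet.{u}) (C : Model L) : Prop :=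
  K.memCard μ C ∧ A ≠ C ∧ ∃ (hAB : K.le A B) (hb : b ∈ B.carrier) (hAC : K.le A C)
    (D F : Model L) (hCD : K.le C D) (hCF : K.le C F) (fD : K.Emb B D) (fF : K.Emb B F),
    K.memCard μ D ∧ K.memCard μ F ∧
    K.IsAmalgamation (AEC.incl hAB) (AEC.incl hAC) fD (AEC.incl hCD) ∧
    K.IsAmalgamation (AEC.incl hAB) (AEC.incl hAC) fF (AEC.incl hCF) ∧
    ¬ K.AmalgEquiv fD (AEC.incl hCD) fF (AEC.incl hCF) ∧
    AEC.tp hCD (fD ⟨b, hb⟩) = AEC.tp hCF (fF ⟨b, hb⟩) ∧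
    s.NonForking A (AEC.tp hCD (fD ⟨b, hb⟩))

/-- `(A, B, b) ∈ K^{3,uq}`: uniqueness triples. -/
def IsUniquenessTriple (A B : Model L) (b : ZFSet.{u}) : Prop :=
  s.IsBasicTriple μ A B b ∧ ¬ ∃ C : Model L, s.WitnessesNonUniqueness μ A B b C

/-- The uniqueness triples are dense among the basic triples with respect to `≤_bs`. -/
def UniquenessTriplesDense : Prop :=
  ∀ (A B : Model L) (b : ZFSet.{u}), s.IsBasicTriple μ A B b →
    ∃ C D : Model L, s.IsUniquenessTriple μ C D b ∧ s.LeBasic A B C D b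

end FrameData

/-- The non-`μ`-splitting frame `s_ns` of `K`: the relation holds of `(A, B, c, C)` iff
`A, B, C ∈ K_μ`, `A ≤_K B <_K C`, `c ∈ C \ B` and `tp(c/B; C)` does not `μ`-split over `A`; the
basic types are the non-algebraic types. -/
def nonSplittingFrame (K : AEC L) (μ : Cardinal.{u}) : FrameData K where
  nf := fun A B C c =>
    K.memCard μ A ∧ K.memCard μ B ∧ K.memCard μ C ∧ K.le A B ∧ B ≠ C ∧
      (c : ZFSet.{u}) ∉ B.carrier ∧
        ∃ h : K.le B C, (AEC.tp h c).DoesNotSplit μ A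
  basic := fun A => K.nonalgebraic A

/-- Jensen's `◇(κ)`, for ordinals below `κ`: there are sets `D a ⊆ a` (`a < κ`) such that for every
`X ⊆ κ` the set of all `a` with `X ∩ a = D a` is stationary in `κ`. -/
def Diamond (κ : Cardinal.{u}) : Prop :=
  ∃ D : κ.ord.ToType → Set κ.ord.ToType, (∀ a, D a ⊆ Set.Iio a) ∧
    ∀ X : Set κ.ord.ToType, IsStationary {a | X ∩ Set.Iio a = D a}

end AECFrame

/-! Argue by contradiction: suppose no uniqueness triple lies above `(A, B, b)` in the required
sense. Fix in advance a model `N₀` of size `μ⁺` above `A` that is saturated for models in `K_μ`, a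
model `N₁` of size `μ⁺` universal over `N₀`, and a set `W` of size `μ⁺` containing `B`. Amalgamation
and stability in `K_{μ⁺}` provide `N₀` and `N₁` (`exists_saturated`, `exists_universalOver`). Since
`W` and `N₁` are fixed and have size `μ⁺`, diamond can guess partial maps from `W` to `N₁`
(`exists_guess_graph`).

Build a chain of length `μ⁺` of non-splitting triples `(C_α, D_α, b)` with `D_α ⊆ W`, together with
increasing embeddings `e_α : C_α → N₀` (`exists_defeating_chain`). At step `α` the triple is not a
uniqueness triple, so `D_α` has two inequivalent amalgams with some `C₁` over `C_α`. Saturation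
first extends `e_α` to `e₁ : C₁ → N₀`. If both amalgams mapped into `N₁` extending `e₁` and inducing
the guessed map on `D_α`, these two maps would witness that the amalgams are equivalent. So one
amalgam refutes the guess, and it becomes the next stage (`NonSplittingTriple.exists_extension`).
Transitivity keeps the type non-splitting over `A` at successors, continuity at limits.

The unions `C ≤ D` have size `μ⁺`. Amalgamating `D` with `N₀` over `C` along `e = ⋃ e_α`, and then
using universality of `N₁` over `N₀`, gives `g : D → N₁` extending `e`. Diamond guesses `g` on some
`D_δ` correctly, but stage `δ + 1` was chosen so that no map extending `e` agrees with that guess.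
-/

namespace AECFrame

open FirstOrder.Language FirstOrder.Language.Structure

variable {L : FirstOrder.Language.{u, u}}

/-! ### Submodels, copies and unions -/

namespace Model

variable {A B C : Model L}

theorem IsSubmodel.refl (A : Model L) : A.IsSubmodel A :=
  ⟨subset_rfl, fun _ _ _ => rfl, fun _ _ _ => Iff.rfl⟩

theorem IsSubmodel.funMap_val (h : A.IsSubmodel B) {n : ℕ} (f : L.Functions n) (x : Fin n → A)
    (y : Fin n → B) (hxy : ∀ i, (x i : ZFSet.{u}) = y i) :
    ((funMap f x : A) : ZFSet.{u}) = (funMap f y : B) := by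
  have hy : y = fun i => Set.inclusion h.subset (x i) := by
    funext i; exact Subtype.ext (hxy i).symm
  rw [hy, ← h.map_fun]

theorem IsSubmodel.relMap_val (h : A.IsSubmodel B) {n : ℕ} (r : L.Relations n) (x : Fin n → A)
    (y : Fin n → B) (hxy : ∀ i, (x i : ZFSet.{u}) = y i) : RelMap r x ↔ RelMap r y := by
  have hy : y = fun i => Set.inclusion h.subset (x i) := by
    funext i; exact Subtype.ext (hxy i).symm
  rw [hy, h.map_rel]

theorem IsSubmodel.of_val (h : A.carrier ⊆ B.carrier)
    (hf : ∀ (n : ℕ) (f : L.Functions n) (x : Fin n → A) (y : Fin n → B),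
      (∀ i, (x i : ZFSet.{u}) = y i) → ((funMap f x : A) : ZFSet.{u}) = (funMap f y : B))
    (hr : ∀ (n : ℕ) (r : L.Relations n) (x : Fin n → A) (y : Fin n → B),
      (∀ i, (x i : ZFSet.{u}) = y i) → (RelMap r x ↔ RelMap r y)) : A.IsSubmodel B :=
  ⟨h, fun n f x => Subtype.ext (hf n f x _ fun _ => rfl),
    fun n r x => (hr n r x _ fun _ => rfl).symm⟩

theorem IsSubmodel.of_subset (hA : A.IsSubmodel C) (hB : B.IsSubmodel C)
    (h : A.carrier ⊆ B.carrier) : A.IsSubmodel B := by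
  refine .of_val h (fun n f x y hxy => ?_) (fun n r x y hxy => ?_)
  · rw [hA.funMap_val f x (fun i => ⟨x i, hA.subset (x i).2⟩) fun _ => rfl,
      hB.funMap_val f y (fun i => ⟨x i, hA.subset (x i).2⟩) fun i => (hxy i).symm]
  · rw [hA.relMap_val r x (fun i => ⟨x i, hA.subset (x i).2⟩) fun _ => rfl,
      hB.relMap_val r y (fun i => ⟨x i, hA.subset (x i).2⟩) fun i => (hxy i).symm]

theorem IsSubmodel.antisymm (h : A.IsSubmodel B) (h' : B.IsSubmodel A) : A = B := by
  have hc : A.carrier = B.carrier := h.subset.antisymm h'.subset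
  obtain ⟨S, hS, sA⟩ := A
  obtain ⟨T, hT, sB⟩ := B
  obtain rfl : S = T := hc
  congr 1
  refine FirstOrder.Language.Structure.ext ?_ ?_
  · funext n f x
    exact Subtype.ext (h.funMap_val f x x fun _ => rfl)
  · funext n r x
    exact propext (h.relMap_val r x x fun _ => rfl)

/-- The copy of a model along an injection of its universe. -/
noncomputable def copy (A : Model L) (j : A → ZFSet.{u}) (hj : Function.Injective j) :
    Model L where
  carrier := Set.range j
  small := by
    have := A.small
    exact small_range j
  str := (Equiv.ofInjective j hj).inducedStructure

/-- The isomorphism of a model with its copy. -/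
noncomputable def copyIso (A : Model L) (j : A → ZFSet.{u}) (hj : Function.Injective j) :
    A ≃[L] A.copy j hj :=
  (Equiv.ofInjective j hj).inducedStructureEquiv

@[simp]
theorem copyIso_val (A : Model L) (j : A → ZFSet.{u}) (hj : Function.Injective j) (a : A) :
    (A.copyIso j hj a : ZFSet.{u}) = j a := rfl

theorem IsUnion.isSubmodel {U : Model L} {A : Ordinal.{u} → Model L} {δ : Ordinal.{u}}
    (h : U.IsUnion A δ) {α : Ordinal.{u}} (hα : α < δ) : (A α).IsSubmodel U := h.1 α hα

theorem IsUnion.mem_iff {U : Model L} {A : Ordinal.{u} → Model L} {δ : Ordinal.{u}}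
    (h : U.IsUnion A δ) {x : ZFSet.{u}} : x ∈ U.carrier ↔ ∃ α < δ, x ∈ (A α).carrier := by
  rw [h.2]; rfl

theorem IsUnion.congr {U : Model L} {A A' : Ordinal.{u} → Model L} {δ : Ordinal.{u}}
    (h : U.IsUnion A δ) (hA : ∀ α < δ, A α = A' α) : U.IsUnion A' δ := by
  refine ⟨fun α hα => hA α hα ▸ h.1 α hα, ?_⟩
  rw [h.2]
  ext x
  exact ⟨fun ⟨α, hα, hx⟩ => ⟨α, hα, hA α hα ▸ hx⟩, fun ⟨α, hα, hx⟩ => ⟨α, hα, (hA α hα).symm ▸ hx⟩⟩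

/-- The maximum of finitely many indices is again below `δ`; positivity of `δ` covers the empty
tuple. This is why finitary symbols can be interpreted in a union. -/
theorem exists_bound_of_fin {S : Ordinal.{u} → Set ZFSet.{u}} {δ : Ordinal.{u}} (hδ : 0 < δ)
    (hS : ∀ α β, α ≤ β → β < δ → S α ⊆ S β) {n : ℕ} (x : Fin n → ZFSet.{u})
    (hx : ∀ i, ∃ α < δ, x i ∈ S α) : ∃ α < δ, ∀ i, x i ∈ S α := by
  choose a ha hxa using hx
  refine ⟨Finset.univ.sup a, ?_, fun i => hS _ _ (Finset.le_sup (Finset.mem_univ i)) ?_ (hxa i)⟩ <;>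
  exact (Finset.sup_lt_iff (by simpa using hδ)).2 fun i _ => ha i

open Classical in
/-- The union of a chain of models exists. -/
theorem exists_isUnion (A : Ordinal.{u} → Model L) {δ : Ordinal.{u}} (hδ : 0 < δ)
    (hA : ∀ α β, α ≤ β → β < δ → (A α).IsSubmodel (A β)) : ∃ U : Model L, U.IsUnion A δ := by
  let S : Set ZFSet.{u} := {x | ∃ α < δ, x ∈ (A α).carrier}
  have hS : Small.{u} S := by
    have : S = ⋃ α ∈ Set.Iio δ, (A α).carrier := by
      ext x; simp [S]
    rw [this]
    have : ∀ α, Small.{u} (A α).carrier := fun α => (A α).small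
    infer_instance
  have hsub : ∀ α < δ, (A α).carrier ⊆ S := fun α hα x hx => ⟨α, hα, hx⟩
  have key : ∀ (n : ℕ) (x : Fin n → S), ∃ α, ∃ _ : α < δ, ∃ y : Fin n → A α,
      ∀ i, (y i : ZFSet.{u}) = x i := by
    intro n x
    obtain ⟨α, hα, h⟩ := exists_bound_of_fin hδ (fun α β h h' => (hA α β h h').subset)
      (fun i => (x i : ZFSet.{u})) fun i => (x i).2
    exact ⟨α, hα, fun i => ⟨x i, h i⟩, fun _ => rfl⟩
  choose a ha y hy using key
  -- Each symbol is evaluated at a tuple in some chosen stage containing it. Independence of that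
  -- choice is checked below by comparing two stages inside the later one.
  let U : Model L := ⟨S, hS,
    ⟨fun {n} f x => ⟨(funMap f (y n x) : A (a n x)), hsub _ (ha n x) (Subtype.prop _)⟩,
      fun {n} r x => RelMap r (y n x)⟩⟩
  refine ⟨U, fun α hα => ?_, rfl⟩
  have hmono : ∀ β, β < δ → (A α).IsSubmodel (A (max α β)) ∧ (A β).IsSubmodel (A (max α β)) :=
    fun β hβ => ⟨hA _ _ (le_max_left _ _) (max_lt hα hβ), hA _ _ (le_max_right _ _) (max_lt hα hβ)⟩
  refine .of_val (hsub α hα) (fun n f x z hxz => ?_) (fun n r x z hxz => ?_)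
  · obtain ⟨h1, h2⟩ := hmono _ (ha n z)
    have e1 := h1.funMap_val f x (fun i => ⟨x i, h1.subset (x i).2⟩) fun _ => rfl
    have e2 := h2.funMap_val f (y n z) (fun i => ⟨x i, h1.subset (x i).2⟩) fun i => by
      rw [hy n z i, ← hxz i]
    exact e1.trans e2.symm
  · obtain ⟨h1, h2⟩ := hmono _ (ha n z)
    have e1 := h1.relMap_val r x (fun i => ⟨x i, h1.subset (x i).2⟩) fun _ => rfl
    have e2 := h2.relMap_val r (y n z) (fun i => ⟨x i, h1.subset (x i).2⟩) fun i => by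
      rw [hy n z i, ← hxz i]
    exact e1.trans e2.symm

end Model

/-! ### Embeddings -/

namespace AEC

variable {K : AEC L} {A B C D : Model L}

/-- The submodel hypotheses of coherence are automatic inside a common extension, so only the
containment of universes has to be checked. -/
theorem le_of_subset (hA : K.le A C) (hB : K.le B C) (h : A.carrier ⊆ B.carrier) : K.le A B :=
  K.coherence ((K.isSubmodel hA).of_subset (K.isSubmodel hB) h) (K.isSubmodel hB) hA hB

theorem le_subset (h : K.le A B) : A.carrier ⊆ B.carrier := (K.isSubmodel h).subset

theorem eq_of_le_of_subset (h : K.le A B) (h' : B.carrier ⊆ A.carrier) : A = B :=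
  (K.isSubmodel h).antisymm
    ((Model.IsSubmodel.refl B).of_subset (K.isSubmodel h) h')

@[simp]
theorem incl_val (h : K.le A B) (a : A) : (incl h a : ZFSet.{u}) = a := rfl

theorem Emb.injective (f : K.Emb A B) : Function.Injective f := f.toEmbedding.injective

/-- The embedding of `A` into `B` given by an isomorphism with a strong submodel of `B`. -/
def Emb.ofIso {A' : Model L} (ψ : A ≃[L] A') (h : K.le A' B) : K.Emb A B where
  toEmbedding := (incl h).toEmbedding.comp ψ.toEmbedding
  strong := ⟨A', h, by
    ext y
    constructor
    · intro hy
      exact ⟨ψ.symm ⟨y, hy⟩, congrArg Subtype.val (ψ.apply_symm_apply ⟨y, hy⟩)⟩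
    · rintro ⟨a, rfl⟩
      exact (ψ a).2⟩

@[simp]
theorem Emb.ofIso_val {A' : Model L} (ψ : A ≃[L] A') (h : K.le A' B) (a : A) :
    (Emb.ofIso ψ h a : ZFSet.{u}) = ψ a := rfl

/-- An embedding is an isomorphism onto its image. -/
theorem Emb.exists_image (f : K.Emb A B) : ∃ (A' : Model L) (_ : K.le A' B) (ψ : A ≃[L] A'),
    ∀ a, (ψ a : ZFSet.{u}) = f a := by
  obtain ⟨A', h, hA'⟩ := f.strong
  have hmem : ∀ a, (f a : ZFSet.{u}) ∈ A'.carrier := fun a => by rw [hA']; exact ⟨a, rfl⟩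
  let g : A → A' := fun a => ⟨f a, hmem a⟩
  have hg : Function.Bijective g := by
    refine ⟨fun a b hab => f.injective (Subtype.ext (by simpa [g] using hab)), fun y => ?_⟩
    obtain ⟨a, ha⟩ := hA'.subset y.2
    exact ⟨a, Subtype.ext ha⟩
  refine ⟨A', h, ⟨Equiv.ofBijective g hg, fun {n} F x => ?_, fun {n} r x => ?_⟩, fun a => rfl⟩
  · refine Subtype.ext ?_
    have := (K.isSubmodel h).funMap_val F (fun i => g (x i)) (fun i => f (x i)) fun _ => rfl
    refine Eq.trans ?_ this.symm
    exact congrArg Subtype.val (f.toEmbedding.map_fun F x)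
  · have := (K.isSubmodel h).relMap_val r (fun i => g (x i)) (fun i => f (x i)) fun _ => rfl
    exact this.trans (f.toEmbedding.map_rel r x)

/-- The image of a strong submodel under an isomorphism. -/
theorem exists_image_iso (φ : B ≃[L] C) (h : K.le A B) : ∃ (A' : Model L) (_ : K.le A' C)
    (ψ : A ≃[L] A'), ∀ a, (ψ a : ZFSet.{u}) = φ (incl h a) := by
  have hj : Function.Injective fun a : A => (φ (incl h a) : ZFSet.{u}) := fun a b hab =>
    (incl h).injective (φ.injective (Subtype.ext hab))
  refine ⟨A.copy _ hj, K.le_iso φ (A.copyIso _ hj) h fun a b hab => ?_, A.copyIso _ hj,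
    fun a => rfl⟩
  obtain rfl : incl h a = b := Subtype.ext hab
  rfl

/-- Composition of embeddings. -/
def Emb.comp (g : K.Emb B C) (f : K.Emb A B) : K.Emb A C where
  toEmbedding := g.toEmbedding.comp f.toEmbedding
  strong := by
    obtain ⟨A', hA', ψ, hψ⟩ := f.exists_image
    obtain ⟨B', hB', φ, hφ⟩ := g.exists_image
    obtain ⟨A'', hA'', χ, hχ⟩ := exists_image_iso φ hA'
    refine ⟨A'', K.trans hA'' hB', ?_⟩
    have key : ∀ a, (χ (ψ a) : ZFSet.{u}) = g (f a) := fun a => by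
      rw [hχ, hφ, show incl hA' (ψ a) = f a from Subtype.ext (hψ a)]
    ext y
    constructor
    · intro hy
      refine ⟨ψ.symm (χ.symm ⟨y, hy⟩), ?_⟩
      refine (key _).symm.trans ?_
      simp
    · rintro ⟨a, rfl⟩
      exact (key a) ▸ (χ (ψ a)).2

@[simp]
theorem Emb.comp_apply (g : K.Emb B C) (f : K.Emb A B) (a : A) : g.comp f a = g (f a) := rfl

theorem memCard.iso {μ : Cardinal.{u}} (h : K.memCard μ A) (φ : A ≃[L] B) : K.memCard μ B :=
  ⟨K.mem_iso φ h.1, (Cardinal.mk_congr φ.toEquiv).symm.trans h.2⟩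

theorem mk_le_of_emb (f : K.Emb A B) : #A.carrier ≤ #B.carrier :=
  Cardinal.mk_le_of_injective f.injective

theorem mk_le_of_le (h : K.le A B) : #A.carrier ≤ #B.carrier := mk_le_of_emb (incl h)

open Classical in
/-- Renaming the elements of `D`, one turns an embedding of `B` into `D` into an inclusion; the
new elements can be taken in any set that has enough elements outside `B`. -/
theorem Emb.exists_copy_in (f : K.Emb B D) (S : Set ZFSet.{u})
    (hS : #D.carrier ≤ #(S \ B.carrier : Set ZFSet.{u})) :
    ∃ (E : Model L) (_ : K.le B E) (φ : D ≃[L] E), (∀ b, (φ (f b) : ZFSet.{u}) = b) ∧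
      E.carrier ⊆ B.carrier ∪ S := by
  obtain ⟨i⟩ := hS
  obtain ⟨B', hB', ψ, hψ⟩ := f.exists_image
  -- On the image of `f` the renaming undoes `f`; elsewhere it uses the injection `i` into `S` minus
  -- `B`. The two ranges are disjoint, so `j` is injective.
  let j : D → ZFSet.{u} := fun d => if h : (d : ZFSet.{u}) ∈ B'.carrier then ψ.symm ⟨d, h⟩ else i d
  have hj1 : ∀ (d : D) (h : (d : ZFSet.{u}) ∈ B'.carrier), j d = ψ.symm ⟨d, h⟩ := fun d h => dif_pos h
  have hj2 : ∀ (d : D) (_ : (d : ZFSet.{u}) ∉ B'.carrier), j d = i d := fun d h => dif_neg h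
  have hj : Function.Injective j := by
    intro d e hde
    by_cases hd : (d : ZFSet.{u}) ∈ B'.carrier <;> by_cases he : (e : ZFSet.{u}) ∈ B'.carrier
    · rw [hj1 d hd, hj1 e he] at hde
      have := ψ.symm.injective (Subtype.ext hde)
      exact Subtype.ext (Subtype.mk.inj this)
    · rw [hj1 d hd, hj2 e he] at hde
      exact absurd (hde ▸ (ψ.symm ⟨d, hd⟩).2) (i e).2.2
    · rw [hj2 d hd, hj1 e he] at hde
      exact absurd (hde.symm ▸ (ψ.symm ⟨e, he⟩).2) (i d).2.2
    · rw [hj2 d hd, hj2 e he] at hde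
      exact i.injective (Subtype.ext hde)
  refine ⟨D.copy j hj, K.le_iso (D.copyIso j hj) ψ.symm hB' ?_, D.copyIso j hj, ?_, ?_⟩
  · intro a b hab
    rw [Model.copyIso_val, hj1 b (hab ▸ a.2)]
    congr 2
    exact Subtype.ext hab
  · intro b
    have hb : (f b : ZFSet.{u}) ∈ B'.carrier := hψ b ▸ (ψ b).2
    rw [Model.copyIso_val, hj1 _ hb, show (⟨f b, hb⟩ : B') = ψ b from Subtype.ext (hψ b).symm]
    simp
  · rintro _ ⟨d, rfl⟩
    by_cases hd : (d : ZFSet.{u}) ∈ B'.carrier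
    · rw [hj1 d hd]; exact Or.inl (Subtype.prop _)
    · rw [hj2 d hd]; exact Or.inr (i d).2.1

/-- Otherwise the complement of the small set `T` would be small, hence so would `ZFSet`, and there
would be a set of all sets, a member of itself. -/
theorem mk_le_mk_compl {S T : Set ZFSet.{u}} (hS : Small.{u} S) (hT : Small.{u} T) :
    #S ≤ #(Set.univ \ T : Set ZFSet.{u}) := by
  rcases le_total #S #(Set.univ \ T : Set ZFSet.{u}) with h | h
  · exact h
  · exfalso
    obtain ⟨i⟩ := h
    have h1 : Small.{u} (Set.univ \ T : Set ZFSet.{u}) := small_of_injective i.injective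
    have h2 : Small.{u} (Set.univ : Set ZFSet.{u}) := by
      have : (Set.univ : Set ZFSet.{u}) = (Set.univ \ T) ∪ T := by simp
      rw [this]
      infer_instance
    have h3 : Small.{u} ZFSet.{u} := small_univ_iff.1 h2
    let V : ZFSet.{u} := ZFSet.range (id : ZFSet.{u} → ZFSet.{u})
    exact ZFSet.mem_irrefl V (ZFSet.mem_range.2 ⟨V, rfl⟩)

/-- Renaming the elements of `D`, one turns an embedding of `B` into `D` into an inclusion. -/
theorem Emb.exists_copy (f : K.Emb B D) :
    ∃ (E : Model L) (_ : K.le B E) (φ : D ≃[L] E), ∀ b, (φ (f b) : ZFSet.{u}) = b := by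
  obtain ⟨E, h, φ, hφ, -⟩ := f.exists_copy_in Set.univ (mk_le_mk_compl D.small B.small)
  exact ⟨E, h, φ, hφ⟩

/-- `Amalgamation` speaks of inclusions only. Renaming `B` and `C` turns the given embeddings into
inclusions, and renaming the amalgam makes it an extension of `C`. -/
theorem Amalgamation.exists_extension {ν : Cardinal.{u}} (hAP : K.Amalgamation ν)
    (hA : K.memCard ν A) (hB : K.memCard ν B) (hC : K.memCard ν C) (gB : K.Emb A B)
    (gC : K.Emb A C) : ∃ (D : Model L) (_ : K.le C D) (fB : K.Emb B D), K.memCard ν D ∧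
      ∀ a, (fB (gB a) : ZFSet.{u}) = gC a := by
  obtain ⟨B', hB', φ, hφ⟩ := gB.exists_copy
  obtain ⟨C', hC', χ, hχ⟩ := gC.exists_copy
  obtain ⟨D, fB, fC, hD, hfg⟩ := hAP A B' C' hA (hB.iso φ) (hC.iso χ) hB' hC'
  have hmB := (K.le_mem hB').2
  have hmC := (K.le_mem hC').2
  let f1 : K.Emb B D := fB.comp (Emb.ofIso φ (K.refl hmB))
  let f2 : K.Emb C D := fC.comp (Emb.ofIso χ (K.refl hmC))
  obtain ⟨E, hE, ρ, hρ⟩ := f2.exists_copy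
  refine ⟨E, hE, (Emb.ofIso ρ (K.refl (K.le_mem hE).2)).comp f1, hD.iso ρ, fun a => ?_⟩
  have e1 : f1 (gB a) = f2 (gC a) := by
    have h1 : Emb.ofIso φ (K.refl hmB) (gB a) = incl hB' a := Subtype.ext (hφ a)
    have h2 : Emb.ofIso χ (K.refl hmC) (gC a) = incl hC' a := Subtype.ext (hχ a)
    simp only [f1, f2, Emb.comp_apply, h1, h2]
    exact hfg a
  rw [Emb.comp_apply, Emb.ofIso_val, e1, hρ]

end AEC

end AECFrame

namespace AECFrame

open Order

variable {L : FirstOrder.Language.{u, u}}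

/-! ### Transfinite constructions -/

/-- Transfinite dependent choice: `Q α s x` says that `x` is an admissible value at `α`, given the
values `s β` for `β < α`. -/
theorem exists_seq {P : Type*} [Nonempty P]
    (Q : Ordinal.{u} → (Ordinal.{u} → P) → P → Prop) (θ : Ordinal.{u})
    (hcongr : ∀ α s t x, (∀ β < α, s β = t β) → Q α s x → Q α t x)
    (hstep : ∀ α ≤ θ, ∀ s : Ordinal.{u} → P, (∀ β < α, Q β s (s β)) → ∃ x, Q α s x) :
    ∃ s : Ordinal.{u} → P, ∀ α ≤ θ, Q α s (s α) := by
  classical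
  -- Recursion supplies only the values below `α`; `ext` pads them with an arbitrary value, which
  -- `hcongr` makes harmless.
  let ext : (α : Ordinal.{u}) → ((β : Ordinal.{u}) → β < α → P) → Ordinal.{u} → P :=
    fun α f β => if h : β < α then f β h else Classical.arbitrary P
  let F : (α : Ordinal.{u}) → ((β : Ordinal.{u}) → β < α → P) → P :=
    fun α f => Classical.epsilon (Q α (ext α f))
  let s : Ordinal.{u} → P := WellFounded.fix Ordinal.lt_wf F
  have hs : ∀ α, s α = Classical.epsilon (Q α (ext α fun β _ => s β)) := fun α =>
    WellFounded.fix_eq Ordinal.lt_wf F α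
  refine ⟨s, fun α => ?_⟩
  induction α using WellFoundedLT.induction with
  | ind α ih =>
    intro hα
    have he : ∀ β < α, s β = ext α (fun β _ => s β) β := fun β hβ => by simp [ext, hβ]
    obtain ⟨x, hx⟩ := hstep α hα s fun β hβ => ih β hβ (hβ.le.trans hα)
    refine hcongr α _ s _ (fun β hβ => (he β hβ).symm) ?_
    rw [hs α]
    exact Classical.epsilon_spec (p := Q α (ext α fun β _ => s β)) ⟨x, hcongr α _ _ x he hx⟩

theorem exists_enum {α : Type (u + 1)} {S : Set α} (hS : S.Nonempty) {ν : Cardinal.{u}}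
    (h : #S ≤ Cardinal.lift.{u + 1} ν) :
    ∃ t : Ordinal.{u} → α, (∀ i, t i ∈ S) ∧ ∀ x ∈ S, ∃ i < ν.ord, t i = x := by
  have h' : #S ≤ #(Set.Iio ν.ord) := by rw [Cardinal.mk_Iio_ordinal]; simpa using h
  obtain ⟨e⟩ := h'
  have : Nonempty S := hS.to_subtype
  refine ⟨fun i => if hi : i ∈ Set.Iio ν.ord then (Function.invFun e ⟨i, hi⟩ : S) else hS.some, fun i => ?_,
    fun x hx => ⟨e ⟨x, hx⟩, (e ⟨x, hx⟩).2, ?_⟩⟩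
  · dsimp only
    split_ifs
    · exact Subtype.prop _
    · exact hS.some_mem
  · have := (e ⟨x, hx⟩).2
    refine (dif_pos this).trans ?_
    simp [Function.leftInverse_invFun e.injective _]

theorem card_le_of_lt_ord_succ {μ : Cardinal.{u}} {α : Ordinal.{u}} (h : α < (succ μ).ord) :
    α.card ≤ μ := lt_succ_iff.1 (Cardinal.lt_ord.1 h)

theorem isSuccLimit_ord {ν : Cardinal.{u}} (h : ℵ₀ ≤ ν) : IsSuccLimit ν.ord :=
  Cardinal.isSuccLimit_ord h

theorem zero_lt_ord {ν : Cardinal.{u}} (h : ℵ₀ ≤ ν) : 0 < ν.ord := (isSuccLimit_ord h).bot_lt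

theorem mk_biUnion_le {S : Ordinal.{u} → Set ZFSet.{u}} {δ : Ordinal.{u}} {ν : Cardinal.{u}}
    (hν : ℵ₀ ≤ ν) (hδ : δ.card ≤ ν) (hS : ∀ α < δ, #(S α) ≤ Cardinal.lift.{u + 1} ν) :
    #{x | ∃ α < δ, x ∈ S α} ≤ Cardinal.lift.{u + 1} ν := by
  have e : {x | ∃ α < δ, x ∈ S α} = ⋃ α ∈ Set.Iio δ, S α := by ext x; simp
  rw [e]
  refine (Cardinal.mk_biUnion_le _ _).trans ?_
  refine le_trans (b := Cardinal.lift.{u + 1} ν * Cardinal.lift.{u + 1} ν) (mul_le_mul' ?_ ?_) ?_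
  · rw [Cardinal.mk_Iio_ordinal]; exact Cardinal.lift_le.2 hδ
  · exact ciSup_le' fun α => hS α α.2
  · rw [Cardinal.mul_eq_self (by simpa using hν)]

/-- A set of fewer than `κ` elements in the union of an increasing chain of regular length `κ` is
contained in one of the sets of the chain. -/
theorem exists_subset_of_chain {S : Ordinal.{u} → Set ZFSet.{u}} {μ : Cardinal.{u}} (hμ : ℵ₀ ≤ μ)
    (hS : ∀ α β, α ≤ β → β < (succ μ).ord → S α ⊆ S β) {Z : Set ZFSet.{u}}
    (hZ : #Z ≤ Cardinal.lift.{u + 1} μ) (h : ∀ x ∈ Z, ∃ α < (succ μ).ord, x ∈ S α) :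
    ∃ α < (succ μ).ord, Z ⊆ S α := by
  choose! a ha hxa using h
  have : Small.{u} Z := by
    rw [Cardinal.small_iff_lift_mk_lt_univ]
    refine lt_of_le_of_lt ?_ (Cardinal.lift_lt_univ μ)
    simpa using hZ
  let T : Set Ordinal.{u} := a '' Z
  have hT : Cardinal.mk T < Cardinal.lift.{u + 1} (succ μ).ord.cof := by
    rw [(Cardinal.isRegular_succ hμ).cof_ord]
    exact Cardinal.mk_image_le.trans_lt (hZ.trans_lt (Cardinal.lift_lt.2 (lt_succ μ)))
  have hlt : sSup T < (succ μ).ord := by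
    refine Ordinal.sSup_lt_of_lt_cof ?_ ?_
    · simpa using hT
    · rintro _ ⟨x, hx, rfl⟩; exact ha x hx
  refine ⟨sSup T, hlt, fun x hx => hS (a x) _ ?_ hlt (hxa x hx)⟩
  have : Small.{u} T := small_image _ _
  exact le_csSup (Ordinal.bddAbove_of_small) ⟨x, hx, rfl⟩

/-- Choosing one new element at each step injects `θ` into `U`. -/
theorem lift_le_mk_of_strict {S : Ordinal.{u} → Set ZFSet.{u}} {θ : Ordinal.{u}}
    {U : Set ZFSet.{u}} (hS : ∀ α β, α ≤ β → β < θ → S α ⊆ S β) (hU : ∀ α < θ, S α ⊆ U)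
    (hθ : IsSuccLimit θ) (hne : ∀ α < θ, S α ≠ S (succ α)) :
    Cardinal.lift.{u + 1} θ.card ≤ #U := by
  have hs : ∀ α < θ, succ α < θ := fun α hα => hθ.succ_lt hα
  have : ∀ α < θ, ∃ x ∈ S (succ α), x ∉ S α := fun α hα => by
    by_contra! h
    exact hne α hα ((hS _ _ (le_succ α) (hs α hα)).antisymm h)
  choose x hx hx' using this
  rw [← Cardinal.mk_Iio_ordinal]
  refine Cardinal.mk_le_of_injective
    (f := fun α : Set.Iio θ => (⟨x α α.2, hU _ (hs _ α.2) (hx _ _)⟩ : U)) ?_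
  have key : ∀ α β : Set.Iio θ, α < β → x α α.2 ≠ x β β.2 := fun α β hαβ he =>
    hx' β β.2 (hS _ _ (succ_le_of_lt hαβ) β.2 (he ▸ hx α α.2))
  intro α β h
  have h : x α α.2 = x β β.2 := congrArg Subtype.val h
  rcases lt_trichotomy α β with h' | h' | h'
  · exact absurd h (key _ _ h')
  · exact h'
  · exact absurd h.symm (key _ _ h')

namespace AEC

variable {K : AEC L}

theorem IsContChain.le_last {A : Ordinal.{u} → Model L} {θ : Ordinal.{u}}
    (h : IsContChain K.le A θ) {α : Ordinal.{u}} (hα : α ≤ θ) : K.le (A α) (A θ) :=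
  h.mono α θ hα le_rfl

/-- At a limit stage of a recursion the sequence is controlled only below `δ`; overwriting its value
at `δ` by the union gives a chain to which smoothness and continuity apply. -/
theorem exists_isContChain {s : Ordinal.{u} → Model L} {δ : Ordinal.{u}} (hδ : IsSuccLimit δ)
    (hmono : ∀ β γ, β ≤ γ → γ < δ → K.le (s β) (s γ))
    (hcont : ∀ γ < δ, IsSuccLimit γ → (s γ).IsUnion s γ) {U : Model L} (hU : U.IsUnion s δ) :
    ∃ A : Ordinal.{u} → Model L, A δ = U ∧ (∀ β < δ, A β = s β) ∧ IsContChain K.le A δ := by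
  classical
  obtain ⟨hU1, hU2⟩ := K.union δ s U hδ.bot_lt hmono hU
  have hup : ∀ β < δ, Function.update s δ U β = s β := fun β hβ =>
    Function.update_of_ne hβ.ne _ _
  refine ⟨Function.update s δ U, Function.update_self .., hup, fun β γ hβγ hγδ => ?_,
    fun γ hγ hγl => ?_⟩
  · rcases hγδ.eq_or_lt with rfl | hγδ
    · rcases hβγ.eq_or_lt with rfl | hβγ
      · simpa using K.refl hU1
      · rw [hup β hβγ]; simpa using hU2 β hβγ
    · rw [hup γ hγδ, hup β (hβγ.trans_lt hγδ)]; exact hmono β γ hβγ hγδ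
  · refine Model.IsUnion.congr (A := s) ?_ fun β hβ => (hup β (hβ.trans_le hγ)).symm
    rcases hγ.eq_or_lt with rfl | hγ
    · simpa using hU
    · rw [hup γ hγ]; exact hcont γ hγ hγl

/-- `I` is an invariant of the stages and `R` a task performed at each successor step. Limit stages
are forced to be unions, so there only the invariant must be checked. -/
theorem exists_model_chain (θ : Ordinal.{u}) (I : Ordinal.{u} → Model L → Prop)
    (R : Ordinal.{u} → Model L → Model L → Prop) (M₀ : Model L) (hM₀ : K.mem M₀) (h0 : I 0 M₀)
    (hsucc : ∀ α < θ, ∀ M, K.mem M → I α M → ∃ M', K.le M M' ∧ I (succ α) M' ∧ R α M M')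
    (hlim : ∀ δ ≤ θ, IsSuccLimit δ → ∀ A : Ordinal.{u} → Model L, IsContChain K.le A δ →
      (∀ α < δ, I α (A α)) → I δ (A δ)) :
    ∃ A : Ordinal.{u} → Model L, A 0 = M₀ ∧ IsContChain K.le A θ ∧ (∀ α ≤ θ, I α (A α)) ∧
      ∀ α < θ, R α (A α) (A (succ α)) := by
  let Q : Ordinal.{u} → (Ordinal.{u} → Model L) → Model L → Prop := fun α s x =>
    (α = 0 → x = M₀) ∧ (∀ β < α, K.le (s β) x) ∧ K.mem x ∧ I α x ∧
      (∀ β, α = succ β → R β (s β) x) ∧ (IsSuccLimit α → x.IsUnion s α)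
  have : Nonempty (Model L) := ⟨M₀⟩
  obtain ⟨A, hA⟩ := exists_seq Q θ
    (by
      rintro α s t x hst ⟨h1, h2, h3, h4, h5, h6⟩
      refine ⟨h1, fun β hβ => hst β hβ ▸ h2 β hβ, h3, h4, ?_, fun hl => (h6 hl).congr hst⟩
      rintro β rfl
      exact hst β (lt_succ β) ▸ h5 β rfl)
    (by
      intro α hα s hs
      have hmono : ∀ β γ, β ≤ γ → γ < α → K.le (s β) (s γ) := fun β γ hβγ hγ => by
        rcases hβγ.eq_or_lt with rfl | h
        · exact K.refl (hs _ hγ).2.2.1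
        · exact (hs γ hγ).2.1 β h
      rcases Ordinal.zero_or_succ_or_isSuccLimit α with rfl | ⟨β, rfl⟩ | hl
      · refine ⟨M₀, fun _ => rfl, fun β hβ => absurd hβ (not_lt_bot), hM₀, h0,
          fun β hβ => absurd hβ.symm (succ_ne_bot β), fun h => absurd h ?_⟩
        exact Ordinal.not_isSuccLimit_zero
      · have hβ : β < succ β := lt_succ β
        obtain ⟨M', h1, h2, h3⟩ := hsucc β (hβ.trans_le hα) (s β) (hs β hβ).2.2.1 (hs β hβ).2.2.2.1
        refine ⟨M', fun h => absurd h (succ_ne_bot β),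
          fun γ hγ => K.trans (hmono γ β (lt_succ_iff.1 hγ) hβ) h1, (K.le_mem h1).2, h2,
          fun γ hγ => ?_, fun h => absurd h (not_isSuccLimit_succ β)⟩
        obtain rfl := succ_injective hγ
        exact h3
      · obtain ⟨U, hU⟩ := Model.exists_isUnion s hl.bot_lt
          fun β γ h h' => K.isSubmodel (hmono β γ h h')
        obtain ⟨hU1, hU2⟩ := K.union α s U hl.bot_lt hmono hU
        obtain ⟨A, rfl, hA, hAc⟩ := exists_isContChain hl hmono
          (fun γ hγ => (hs γ hγ).2.2.2.2.2) hU
        exact ⟨A α, fun h => absurd (h ▸ hl) Ordinal.not_isSuccLimit_zero, hU2, hU1,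
          hlim α hα hl A hAc fun β hβ => by rw [hA β hβ]; exact (hs β hβ).2.2.2.1,
          fun β hβ => absurd (hβ ▸ hl) (not_isSuccLimit_succ β), fun _ => hU⟩)
  refine ⟨A, (hA 0 (zero_le)).1 rfl, ⟨fun α β h h' => ?_, fun γ hγ hl => (hA γ hγ).2.2.2.2.2 hl⟩,
    fun α hα => (hA α hα).2.2.2.1, fun α hα => (hA _ (succ_le_of_lt hα)).2.2.2.2.1 α rfl⟩
  rcases h.eq_or_lt with rfl | h
  · exact K.refl (hA _ h').2.2.1
  · exact (hA β h').2.1 α h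

/-- Chains of models of a fixed cardinality `ν`; only the last model may be larger. -/
theorem exists_chain {ν : Cardinal.{u}} (hν : ℵ₀ ≤ ν) (θ : Ordinal.{u})
    (hθ : ∀ α < θ, α.card ≤ ν) (I : Model L → Prop)
    (R : Ordinal.{u} → Model L → Model L → Prop) (M₀ : Model L) (hM₀ : K.memCard ν M₀)
    (h0 : I M₀)
    (hsucc : ∀ α < θ, ∀ M, K.memCard ν M → I M →
      ∃ M', K.le M M' ∧ K.memCard ν M' ∧ I M' ∧ R α M M')
    (hlim : ∀ δ ≤ θ, IsSuccLimit δ → ∀ A : Ordinal.{u} → Model L, IsContChain K.le A δ →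
      (∀ α < δ, I (A α)) → I (A δ)) :
    ∃ A : Ordinal.{u} → Model L, A 0 = M₀ ∧ IsContChain K.le A θ ∧
      (∀ α ≤ θ, α.card ≤ ν → K.memCard ν (A α)) ∧ (∀ α ≤ θ, I (A α)) ∧
      ∀ α < θ, R α (A α) (A (succ α)) := by
  obtain ⟨A, h1, h2, h3, h4⟩ := exists_model_chain (K := K) θ
    -- The cardinality clause is conditional so that chains of length `ν⁺`, whose union may be
    -- larger, are covered too.
    (fun α M => (α.card ≤ ν → K.memCard ν M) ∧ I M) R M₀ hM₀.1 ⟨fun _ => hM₀, h0⟩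
    (fun α hα M _ hM => by
      obtain ⟨M', a, b, c, d⟩ := hsucc α hα M (hM.1 (hθ α hα)) hM.2
      exact ⟨M', a, ⟨fun _ => b, c⟩, d⟩)
    (fun δ hδ hl A hA hI => by
      refine ⟨fun hc => ⟨(K.le_mem (hA.mono δ δ le_rfl le_rfl)).1, le_antisymm ?_ ?_⟩,
        hlim δ hδ hl A hA fun α hα => (hI α hα).2⟩
      · rw [(hA.cont δ le_rfl hl).2]
        refine mk_biUnion_le (S := fun α => (A α).carrier) hν hc fun α hα => ?_
        exact ((hI α hα).1 ((Ordinal.card_le_card hα.le).trans hc)).2.le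
      · rw [← ((hI 0 hl.bot_lt).1 (by simp)).2]
        exact mk_le_of_le (hA.mono 0 δ (zero_le) le_rfl))
  exact ⟨A, h1, h2, fun α hα => (h3 α hα).1, fun α hα => (h3 α hα).2, h4⟩

/-! ### The Löwenheim–Skolem–Tarski number -/

variable (K) in
theorem lst_property : LSTProperty K.mem K.le K.LST := csInf_mem K.exists_lst

theorem aleph0_le_of_lst {ν : Cardinal.{u}} (h : K.LST ≤ ν) : ℵ₀ ≤ ν := K.lst_property.1.trans h

/-- The Löwenheim–Skolem–Tarski property bounds the size from above only; throwing a set `Y` of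
exactly `ν` elements into `Z` gives the lower bound. -/
theorem exists_le_of_lst {ν : Cardinal.{u}} (h : K.LST ≤ ν) {N : Model L} (hN : K.mem N)
    {Z : Set ZFSet.{u}} (hZ : Z ⊆ N.carrier) (hZc : #Z ≤ Cardinal.lift.{u + 1} ν)
    (hNc : Cardinal.lift.{u + 1} ν ≤ #N.carrier) :
    ∃ M : Model L, K.le M N ∧ Z ⊆ M.carrier ∧ K.memCard ν M := by
  have hν : ℵ₀ ≤ Cardinal.lift.{u + 1} ν := by simpa using aleph0_le_of_lst h
  obtain ⟨Y, hY, hYc⟩ := Cardinal.le_mk_iff_exists_subset.1 hNc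
  obtain ⟨M, hM, hZM, hMc⟩ := K.lst_property.2.2 N hN (Z ∪ Y) (Set.union_subset hZ hY)
  refine ⟨M, hM, Set.subset_union_left.trans hZM, (K.le_mem hM).1, le_antisymm (hMc.trans ?_) ?_⟩
  · refine max_le (by simpa using h) ((Cardinal.mk_union_le _ _).trans ?_)
    exact Cardinal.add_le_of_le hν hZc hYc.le
  · rw [← hYc]
    exact Cardinal.mk_le_mk_of_subset (Set.subset_union_right.trans hZM)

end AEC

end AECFrame

namespace AECFrame

open Order FirstOrder.Language.Structure

variable {L : FirstOrder.Language.{u, u}}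

namespace AEC

variable {K : AEC L} {A B C D : Model L}

/-! ### Types and amalgamation -/

theorem tp_eq_of_emb (hB : K.le A B) (hD : K.le A D) (f : K.Emb B D)
    (hf : ∀ a : A, (f (incl hB a) : ZFSet.{u}) = a) (b : B) : tp hB b = tp hD (f b) :=
  Quot.sound ⟨D, f, incl (K.refl (K.le_mem hD).2), fun a => Subtype.ext (hf a), rfl⟩

theorem tp_eq_of_le (hB : K.le A B) (hD : K.le A D) (h : K.le B D) (b : B) :
    tp hB b = tp hD (incl h b) :=
  tp_eq_of_emb hB hD (incl h) (fun _ => rfl) b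

/-- An atomic equivalence fixes `A` through injective maps, so it cannot identify a point of `A`
with a point outside; membership in `A` therefore factors through the quotient defining types. -/
theorem mem_iff_of_tp_eq {hB : K.le A B} {hD : K.le A D} {b : B} {d : D}
    (h : tp hB b = tp hD d) : (b : ZFSet.{u}) ∈ A.carrier ↔ (d : ZFSet.{u}) ∈ A.carrier := by
  have key : ∀ P Q : K.Pointed A, Pointed.Rel K P Q →
      ((P.pt : ZFSet.{u}) ∈ A.carrier) = ((Q.pt : ZFSet.{u}) ∈ A.carrier) := by
    rintro P Q ⟨E, f, g, hfg, hpt⟩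
    refine propext ⟨fun hP => ?_, fun hQ => ?_⟩
    · have h1 : P.pt = incl P.le ⟨P.pt, hP⟩ := rfl
      rw [h1, hfg ⟨P.pt, hP⟩] at hpt
      rw [← g.injective hpt]
      exact hP
    · have h1 : Q.pt = incl Q.le ⟨Q.pt, hQ⟩ := rfl
      rw [h1, ← hfg ⟨Q.pt, hQ⟩] at hpt
      rw [f.injective hpt]
      exact hQ
  exact Iff.of_eq (congrArg (Quot.lift (fun P : K.Pointed A => (P.pt : ZFSet.{u}) ∈ A.carrier) key) h)

/-- The image is strong in `B` and contained in `C`, hence strong in `C` by coherence. -/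
theorem Emb.exists_codRestrict (f : K.Emb A B) (hC : K.le C B)
    (h : ∀ a, (f a : ZFSet.{u}) ∈ C.carrier) :
    ∃ g : K.Emb A C, ∀ a, (g a : ZFSet.{u}) = f a := by
  obtain ⟨A', hA', ψ, hψ⟩ := f.exists_image
  have hA'C : K.le A' C := le_of_subset hA' hC fun y hy => by
    have := h (ψ.symm ⟨y, hy⟩)
    rw [← hψ] at this
    simpa using this
  exact ⟨Emb.ofIso ψ hA'C, fun a => hψ a⟩

theorem mk_range_emb_le {ν : Cardinal.{u}} (hA : K.memCard ν A) (f : K.Emb A B) :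
    #(Set.range fun a => (f a : ZFSet.{u})) ≤ Cardinal.lift.{u + 1} ν :=
  Cardinal.mk_range_le.trans hA.2.le

/-- Two models of `K_ν` that embed in a common model embed in a common model of `K_ν`. -/
theorem exists_memCard_of_embs {ν : Cardinal.{u}} (hν : K.LST ≤ ν) (hB : K.memCard ν B)
    (hD : K.memCard ν D) {G : Model L} (f : K.Emb B G) (g : K.Emb D G) :
    ∃ (E : Model L) (_ : K.le D E) (k : K.Emb B E), K.memCard ν E ∧
      ∀ b d, (f b : ZFSet.{u}) = g d → (k b : ZFSet.{u}) = d := by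
  have hG : K.mem G := let ⟨_, h, _⟩ := f.strong; (K.le_mem h).2
  have hν' : ℵ₀ ≤ Cardinal.lift.{u + 1} ν := by simpa using aleph0_le_of_lst hν
  obtain ⟨G₀, hG₀, hsub, hc⟩ := exists_le_of_lst hν hG
    (Z := (Set.range fun b => (f b : ZFSet.{u})) ∪ Set.range fun d => (g d : ZFSet.{u}))
    (Set.union_subset (by rintro _ ⟨b, rfl⟩; exact (f b).2) (by rintro _ ⟨b, rfl⟩; exact (g b).2))
    ((Cardinal.mk_union_le _ _).trans
      (Cardinal.add_le_of_le hν' (mk_range_emb_le hB f) (mk_range_emb_le hD g)))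
    (hB.2 ▸ mk_le_of_emb f)
  obtain ⟨f', hf'⟩ := f.exists_codRestrict hG₀ fun b => hsub (Or.inl ⟨b, rfl⟩)
  obtain ⟨g', hg'⟩ := g.exists_codRestrict hG₀ fun b => hsub (Or.inr ⟨b, rfl⟩)
  obtain ⟨E, hE, φ, hφ⟩ := g'.exists_copy
  refine ⟨E, hE, (Emb.ofIso φ (K.refl (K.le_mem hE).2)).comp f', hc.iso φ, fun b d hbd => ?_⟩
  rw [Emb.comp_apply, Emb.ofIso_val, ← hφ d]
  congr 2
  exact Subtype.ext ((hf' b).trans (hbd.trans (hg' d).symm))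

/-- Equal types over a model of `K_ν` which are realized in models of `K_ν` are identified in an
amalgam that belongs to `K_ν`. -/
theorem exists_amalgam_of_tp_eq {ν : Cardinal.{u}} (hν : K.LST ≤ ν) (hAP : K.Amalgamation ν)
    (hA : K.memCard ν A) (hB : K.memCard ν B) (hD : K.memCard ν D) {hAB : K.le A B}
    {hAD : K.le A D} {b : B} {d : D} (h : tp hAB b = tp hAD d) :
    ∃ (E : Model L) (_ : K.le D E) (f : K.Emb B E), K.memCard ν E ∧
      (∀ a : A, (f (incl hAB a) : ZFSet.{u}) = a) ∧ (f b : ZFSet.{u}) = d := by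
  have hν' : ℵ₀ ≤ Cardinal.lift.{u + 1} ν := by simpa using aleph0_le_of_lst hν
  -- Equality of types is a generated equivalence passing through models of any size, while
  -- amalgamation is available in `K_ν` only. `Sim` therefore states the conclusion for all
  -- submodels in `K_ν` carrying the two points, and is proved by induction on the generation.
  let Sim : K.Pointed A → K.Pointed A → Prop := fun P Q =>
    ∀ (B D : Model L) (hAB : K.le A B) (hAD : K.le A D), K.le B P.model → K.le D Q.model →
      K.memCard ν B → K.memCard ν D → ∀ (b : B) (d : D), (b : ZFSet.{u}) = P.pt →
      (d : ZFSet.{u}) = Q.pt → ∃ (E : Model L) (_ : K.le D E) (f : K.Emb B E), K.memCard ν E ∧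
        (∀ a : A, (f (incl hAB a) : ZFSet.{u}) = a) ∧ (f b : ZFSet.{u}) = d
  have hrel : ∀ P Q, Pointed.Rel K P Q → Sim P Q := by
    rintro P Q ⟨G, f, g, hfg, hpt⟩ B D hAB hAD hBP hDQ hB hD b d hb hd
    obtain ⟨E, hE, k, hEc, hk⟩ := exists_memCard_of_embs hν hB hD (f.comp (incl hBP))
      (g.comp (incl hDQ))
    refine ⟨E, hE, k, hEc, fun a => hk _ (incl hAD a) ?_, hk b d ?_⟩
    · exact congrArg Subtype.val (hfg a)
    · have e1 : incl hBP b = P.pt := Subtype.ext hb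
      have e2 : incl hDQ d = Q.pt := Subtype.ext hd
      rw [Emb.comp_apply, Emb.comp_apply, e1, e2, hpt]
  have hsim : ∀ P Q, Relation.EqvGen (Pointed.Rel K (A := A)) P Q → Sim P Q := by
    intro P Q hPQ
    induction hPQ with
    | rel P Q h => exact hrel P Q h
    | refl P =>
      exact hrel P P ⟨P.model, incl (K.refl (K.le_mem P.le).2), incl (K.refl (K.le_mem P.le).2),
        fun _ => rfl, rfl⟩
    | symm P Q _ ih =>
      intro B D hAB hAD hBP hDQ hB hD b d hb hd
      obtain ⟨E, hE, f, hEc, hf, hfb⟩ := ih D B hAD hAB hDQ hBP hD hB d b hd hb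
      obtain ⟨E', hE', φ, hφ⟩ := f.exists_copy
      refine ⟨E', hE', (Emb.ofIso φ (K.refl (K.le_mem hE').2)).comp (incl hE), hEc.iso φ,
        fun a => ?_, ?_⟩
      · rw [Emb.comp_apply, Emb.ofIso_val, ← incl_val hAD a, ← hφ]
        congr 2
        exact Subtype.ext (hf a).symm
      · rw [Emb.comp_apply, Emb.ofIso_val, ← hφ]
        congr 2
        exact Subtype.ext hfb.symm
    | trans P Q R _ _ ih1 ih2 =>
      intro B D hAB hAD hBP hDQ hB hD b d hb hd
      -- The intermediate model may be large: it is cut down to `Q₀` in `K_ν` containing `A` and the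
      -- point, over which the two smaller amalgams are amalgamated.
      obtain ⟨Q₀, hQ₀, hsub, hQc⟩ := exists_le_of_lst hν (K.le_mem Q.le).2
        (Z := insert (Q.pt : ZFSet.{u}) A.carrier)
        (Set.insert_subset Q.pt.2 (le_subset Q.le))
        ((Cardinal.mk_insert_le).trans
          (Cardinal.add_le_of_le hν' hA.2.le (Cardinal.one_le_aleph0.trans hν')))
        (hA.2 ▸ mk_le_of_le Q.le)
      have hAQ : K.le A Q₀ := le_of_subset Q.le hQ₀ ((Set.subset_insert _ _).trans hsub)
      let q : Q₀ := ⟨Q.pt, hsub (Set.mem_insert _ _)⟩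
      obtain ⟨E₁, hE₁, f, hE₁c, hf, hfb⟩ := ih1 B Q₀ hAB hAQ hBP hQ₀ hB hQc b q hb rfl
      obtain ⟨E₂, hE₂, g, hE₂c, hg, hgb⟩ := ih2 Q₀ D hAQ hAD hQ₀ hDQ hQc hD q d rfl hd
      obtain ⟨E, hE, k, hEc, hk⟩ := hAP.exists_extension hQc hE₁c hE₂c (incl hE₁) g
      refine ⟨E, K.trans hE₂ hE, k.comp f, hEc, fun a => ?_, ?_⟩
      · rw [Emb.comp_apply, ← hg a, ← hk]
        congr 2
        exact Subtype.ext (hf a)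
      · rw [Emb.comp_apply, ← hgb, ← hk]
        congr 2
        exact Subtype.ext hfb
  exact hsim _ _ (Quot.eqvGen_exact h) B D hAB hAD (K.refl hB.1) (K.refl hD.1) hB hD b d rfl rfl

/-! ### Realizing all types -/

/-- All types over `M` are realized in `N`. -/
def RealizesTypes (K : AEC L) (ν : Cardinal.{u}) (M N : Model L) : Prop :=
  ∃ hN : K.le M N, ∀ (E : Model L) (hE : K.le M E), K.memCard ν E → ∀ a : E,
    ∃ c : N, tp hE a = tp hN c

/-- By stability the non-algebraic types can be listed in length `ν`; amalgamation realizes one at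
each step of a chain. Algebraic types are realized in `M` itself. -/
theorem exists_realizesTypes {ν : Cardinal.{u}} (hν : K.LST ≤ ν) (hAP : K.Amalgamation ν)
    (hst : K.Stable ν) {M : Model L} (hM : K.memCard ν M) :
    ∃ N : Model L, K.memCard ν N ∧ RealizesTypes K ν M N := by
  have hν0 := aleph0_le_of_lst hν
  have hν' : ℵ₀ ≤ Cardinal.lift.{u + 1} ν := by simpa using hν0
  rcases (K.nonalgebraic M).eq_empty_or_nonempty with hemp | hne
  · refine ⟨M, hM, K.refl hM.1, fun E hE _ a => ?_⟩
    by_cases ha : (a : ZFSet.{u}) ∈ M.carrier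
    · exact ⟨⟨a, ha⟩, (tp_eq_of_le (K.refl hM.1) hE hE ⟨a, ha⟩).symm⟩
    · exact absurd (show tp hE a ∈ K.nonalgebraic M from ⟨E, hE, a, ha, rfl⟩)
        (hemp ▸ Set.notMem_empty _)
  obtain ⟨t, ht, htS⟩ := exists_enum hne (hst M hM)
  have hc : ∀ α < ν.ord, α.card ≤ ν := fun α hα => (Cardinal.lt_ord.1 hα).le
  obtain ⟨X, hX0, hX, hXc, hXI, hXR⟩ := exists_chain (K := K) hν0 ν.ord hc (fun X => K.le M X)
    (fun α _ X' => ∃ (h : K.le M X') (c : X'), t α = tp h c) M hM (K.refl hM.1)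
    (by
      intro α _ X hX hMX
      obtain ⟨B, hMB, b, hb, htb⟩ := ht α
      obtain ⟨B₀, hB₀, hsub, hBc⟩ := exists_le_of_lst hν (K.le_mem hMB).2
        (Z := insert (b : ZFSet.{u}) M.carrier)
        (Set.insert_subset b.2 (le_subset hMB))
        ((Cardinal.mk_insert_le).trans
          (Cardinal.add_le_of_le hν' hM.2.le (Cardinal.one_le_aleph0.trans hν')))
        (hM.2 ▸ mk_le_of_le hMB)
      have hMB₀ : K.le M B₀ := le_of_subset hMB hB₀ ((Set.subset_insert _ _).trans hsub)
      let b₀ : B₀ := ⟨b, hsub (Set.mem_insert _ _)⟩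
      obtain ⟨E, hXE, f, hEc, hf⟩ := hAP.exists_extension hM hBc hX (incl hMB₀) (incl hMX)
      refine ⟨E, hXE, hEc, K.trans hMX hXE, K.trans hMX hXE, f b₀, ?_⟩
      rw [htb, ← tp_eq_of_emb hMB₀ _ f hf b₀, tp_eq_of_le hMB₀ hMB hB₀ b₀]
      rfl)
    (fun δ _ hl A hA hI => K.trans (hI 0 hl.bot_lt) (hA.mono 0 δ (zero_le) le_rfl))
  have hMN : K.le M (X ν.ord) := hXI _ le_rfl
  refine ⟨X ν.ord, hXc _ le_rfl (by simp), hMN, fun E hE _ a => ?_⟩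
  by_cases ha : (a : ZFSet.{u}) ∈ M.carrier
  · refine ⟨incl hMN ⟨a, ha⟩, ?_⟩
    rw [← tp_eq_of_le (K.refl hM.1) hMN hMN ⟨a, ha⟩]
    exact (tp_eq_of_le (K.refl hM.1) hE hE ⟨a, ha⟩).symm
  · obtain ⟨i, hi, hti⟩ := htS (tp hE a) ⟨E, hE, a, ha, rfl⟩
    obtain ⟨h, c, hc⟩ := hXR i hi
    have hle : K.le (X (succ i)) (X ν.ord) := IsContChain.le_last hX (succ_le_of_lt hi)
    exact ⟨incl hle c, by rw [← hti, hc, tp_eq_of_le h hMN hle c]⟩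

/-! ### Embeddings given by functions on the universe of sets -/

/-- The restriction of `f` to `A` is an embedding of `A` into `B`. -/
def EmbOn (K : AEC L) (A B : Model L) (f : ZFSet.{u} → ZFSet.{u}) : Prop :=
  ∃ g : K.Emb A B, ∀ a : A, (g a : ZFSet.{u}) = f a

variable {f f' : ZFSet.{u} → ZFSet.{u}}

theorem EmbOn.trans_le (h : EmbOn K A B f) (hBC : K.le B C) : EmbOn K A C f :=
  let ⟨g, hg⟩ := h
  ⟨(incl hBC).comp g, hg⟩

theorem EmbOn.of_le (h : EmbOn K B C f) (hAB : K.le A B) : EmbOn K A C f :=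
  let ⟨g, hg⟩ := h
  ⟨g.comp (incl hAB), fun a => hg (incl hAB a)⟩

theorem EmbOn.congr (h : EmbOn K A B f) (hf : ∀ x ∈ A.carrier, f x = f' x) : EmbOn K A B f' :=
  let ⟨g, hg⟩ := h
  ⟨g, fun a => (hg a).trans (hf a a.2)⟩

theorem EmbOn.map_mem (h : EmbOn K A B f) {x : ZFSet.{u}} (hx : x ∈ A.carrier) :
    f x ∈ B.carrier :=
  let ⟨g, hg⟩ := h
  hg ⟨x, hx⟩ ▸ (g ⟨x, hx⟩).2

theorem EmbOn.injOn (h : EmbOn K A B f) : Set.InjOn f A.carrier := by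
  obtain ⟨g, hg⟩ := h
  intro x hx y hy hxy
  have : g ⟨x, hx⟩ = g ⟨y, hy⟩ := Subtype.ext (by rw [hg, hg]; exact hxy)
  exact congrArg Subtype.val (g.injective this)

theorem embOn_id (h : K.le A B) : EmbOn K A B id := ⟨incl h, fun _ => rfl⟩

theorem Emb.exists_embOn (g : K.Emb A B) : ∃ f, EmbOn K A B f ∧ ∀ a : A, f a = g a := by
  classical
  refine ⟨fun x => if h : x ∈ A.carrier then g ⟨x, h⟩ else ∅, ⟨g, fun a => ?_⟩, fun a => ?_⟩
  · simp
  · simp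

/-- A function which is an embedding on all members of a chain is one on the union. -/
theorem embOn_limit {δ : Ordinal.{u}} (hδ : IsSuccLimit δ) {M : Ordinal.{u} → Model L}
    (hM : IsContChain K.le M δ) {E : Model L} (h : ∀ α < δ, EmbOn K (M α) E f) :
    EmbOn K (M δ) E f := by
  classical
  -- The images of the stages form a continuous chain of strong submodels of `E`, so smoothness
  -- makes their union, the image of `M δ`, strong in `E`. Beyond `δ` the value is irrelevant.
  have himg : ∀ α, ∃ E' : Model L, α < δ → K.le E' E ∧ E'.carrier = f '' (M α).carrier := by
    intro α
    by_cases hα : α < δ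
    · obtain ⟨g, hg⟩ := h α hα
      obtain ⟨E', hE', hc⟩ := g.strong
      refine ⟨E', fun _ => ⟨hE', ?_⟩⟩
      rw [hc]
      ext y
      constructor
      · rintro ⟨a, rfl⟩; exact ⟨a, a.2, (hg a).symm⟩
      · rintro ⟨a, ha, rfl⟩; exact ⟨⟨a, ha⟩, hg ⟨a, ha⟩⟩
    · exact ⟨E, fun h => absurd h hα⟩
  choose E' hE' using himg
  have hsubM : ∀ α β, α ≤ β → β ≤ δ → (M α).carrier ⊆ (M β).carrier := fun α β h h' =>
    le_subset (hM.mono α β h h')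
  have hmono : ∀ α β, α ≤ β → β < δ → K.le (E' α) (E' β) := fun α β hαβ hβ => by
    have h1 := hE' α (hαβ.trans_lt hβ)
    have h2 := hE' β hβ
    refine le_of_subset h1.1 h2.1 ?_
    rw [h1.2, h2.2]
    exact Set.image_mono (hsubM α β hαβ hβ.le)
  obtain ⟨U, hU⟩ := Model.exists_isUnion E' hδ.bot_lt fun α β h h' => K.isSubmodel (hmono α β h h')
  have hcont : ∀ γ < δ, IsSuccLimit γ → (E' γ).IsUnion E' γ := by
    intro γ hγ hγl
    refine ⟨fun α hα => K.isSubmodel (hmono α γ hα.le hγ), ?_⟩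
    ext y
    rw [(hE' γ hγ).2]
    constructor
    · rintro ⟨x, hx, rfl⟩
      obtain ⟨α, hα, hx⟩ := ((hM.cont γ hγ.le hγl).mem_iff).1 hx
      exact ⟨α, hα, (hE' α (hα.trans hγ)).2 ▸ ⟨x, hx, rfl⟩⟩
    · rintro ⟨α, hα, hy⟩
      rw [(hE' α (hα.trans hγ)).2] at hy
      obtain ⟨x, hx, rfl⟩ := hy
      exact ⟨x, hsubM α γ hα.le hγ.le hx, rfl⟩
  have hUE : K.le U E := by
    obtain ⟨A, rfl, hA, hAc⟩ := exists_isContChain hδ hmono hcont hU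
    exact K.smooth δ A E hδ hAc fun α hα => by rw [hA α hα]; exact (hE' α hα).1
  have hMδ := hM.cont δ le_rfl hδ
  have hfin : ∀ {n : ℕ} (x : Fin n → M δ), ∃ α < δ, ∀ i, (x i : ZFSet.{u}) ∈ (M α).carrier :=
    fun x => Model.exists_bound_of_fin hδ.bot_lt (fun α β h h' => hsubM α β h h'.le) _
      fun i => hMδ.mem_iff.1 (x i).2
  have hmap : ∀ x ∈ (M δ).carrier, f x ∈ E.carrier := fun x hx => by
    obtain ⟨α, hα, hx⟩ := hMδ.mem_iff.1 hx
    exact (h α hα).map_mem hx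
  refine ⟨⟨⟨⟨fun x => ⟨f x, hmap x x.2⟩, fun x y hxy => ?_⟩, fun {n} F x => ?_, fun {n} r x => ?_⟩,
    U, hUE, ?_⟩, fun a => rfl⟩
  · obtain ⟨α, hα, hx⟩ := hfin ![x, y]
    exact Subtype.ext ((h α hα).injOn (hx 0) (hx 1) (congrArg Subtype.val hxy))
  · obtain ⟨α, hα, hx⟩ := hfin x
    obtain ⟨g, hg⟩ := h α hα
    have h1 := (hMδ.isSubmodel hα).funMap_val F (fun i => ⟨x i, hx i⟩) x fun _ => rfl
    have h2 := congrArg Subtype.val (g.toEmbedding.map_fun F fun i => ⟨x i, hx i⟩)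
    refine Subtype.ext ?_
    change f (funMap F x : M δ) = _
    rw [← h1, ← hg]
    refine h2.trans ?_
    congr 2
    funext i
    exact Subtype.ext (hg _)
  · obtain ⟨α, hα, hx⟩ := hfin x
    obtain ⟨g, hg⟩ := h α hα
    have h1 := (hMδ.isSubmodel hα).relMap_val r (fun i => ⟨x i, hx i⟩) x fun _ => rfl
    have h2 := g.toEmbedding.map_rel r fun i => ⟨x i, hx i⟩
    rw [← h1, ← h2]
    refine iff_of_eq ?_
    congr 1
    funext i
    exact Subtype.ext (hg ⟨x i, hx i⟩).symm
  · ext y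
    rw [hU.mem_iff]
    constructor
    · rintro ⟨α, hα, hy⟩
      rw [(hE' α hα).2] at hy
      obtain ⟨x, hx, rfl⟩ := hy
      exact ⟨⟨x, hsubM α δ hα.le le_rfl hx⟩, rfl⟩
    · rintro ⟨x, rfl⟩
      obtain ⟨α, hα, hx⟩ := hMδ.mem_iff.1 x.2
      exact ⟨α, hα, (hE' α hα).2 ▸ ⟨x, hx, rfl⟩⟩

open Classical in
/-- The common extension of a coherent sequence of functions. -/
noncomputable def glue (S : Ordinal.{u} → Set ZFSet.{u}) (δ : Ordinal.{u})
    (f : Ordinal.{u} → ZFSet.{u} → ZFSet.{u}) (x : ZFSet.{u}) : ZFSet.{u} :=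
  if h : ∃ α < δ, x ∈ S α then f h.choose x else ∅

theorem glue_eq {S : Ordinal.{u} → Set ZFSet.{u}} {δ : Ordinal.{u}}
    {f : Ordinal.{u} → ZFSet.{u} → ZFSet.{u}}
    (hf : ∀ α β, α < β → β < δ → ∀ x ∈ S α, f β x = f α x) {α : Ordinal.{u}} (hα : α < δ)
    {x : ZFSet.{u}} (hx : x ∈ S α) : glue S δ f x = f α x := by
  have h : ∃ α < δ, x ∈ S α := ⟨α, hα, hx⟩
  rw [glue, dif_pos h]
  obtain ⟨h1, h2⟩ := h.choose_spec
  rcases lt_trichotomy h.choose α with h' | h' | h'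
  · exact (hf _ _ h' hα x h2).symm
  · rw [h']
  · exact hf _ _ h' h1 x hx

/-- Lifting a chain `M` of models of `K_ν` along an embedding of `M 0`. -/
theorem exists_lift {ν : Cardinal.{u}} (hν : ℵ₀ ≤ ν) (θ : Ordinal.{u})
    (hθ : ∀ α < θ, α.card ≤ ν) {M : Ordinal.{u} → Model L} (hM : IsContChain K.le M θ)
    {E₀ : Model L} (hE₀ : K.memCard ν E₀) {f₀ : ZFSet.{u} → ZFSet.{u}} (hf₀ : EmbOn K (M 0) E₀ f₀)
    (R : Ordinal.{u} → (ZFSet.{u} → ZFSet.{u}) → Prop)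
    (hR : ∀ α f f', (∀ x ∈ (M (succ α)).carrier, f x = f' x) → R α f → R α f')
    (hstep : ∀ α < θ, ∀ (E : Model L) (f : ZFSet.{u} → ZFSet.{u}), K.le E₀ E → K.memCard ν E →
      EmbOn K (M α) E f → ∃ (E' : Model L) (f' : ZFSet.{u} → ZFSet.{u}), K.le E E' ∧
        K.memCard ν E' ∧ EmbOn K (M (succ α)) E' f' ∧ (∀ x ∈ (M α).carrier, f' x = f x) ∧ R α f') :
    ∃ (E : Model L) (f : ZFSet.{u} → ZFSet.{u}), K.le E₀ E ∧ EmbOn K (M θ) E f ∧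
      (∀ x ∈ (M 0).carrier, f x = f₀ x) ∧ ∀ α < θ, R α f := by
  -- A stage is a target model with a function on all sets, of which only the values on `M α`
  -- matter. Extension of maps is then an equation and limits are taken by `glue`. By `hR`, a task
  -- done at step `α` survives to the final function.
  let P := Model L × (ZFSet.{u} → ZFSet.{u})
  let Q : Ordinal.{u} → (Ordinal.{u} → P) → P → Prop := fun α s x =>
    (α = 0 → x = (E₀, f₀)) ∧
    (∀ β < α, K.le (s β).1 x.1 ∧ ∀ z ∈ (M β).carrier, x.2 z = (s β).2 z) ∧
    K.mem x.1 ∧ (α.card ≤ ν → K.memCard ν x.1) ∧ EmbOn K (M α) x.1 x.2 ∧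
    (∀ β, α = succ β → R β x.2)
  have : Nonempty P := ⟨(E₀, f₀)⟩
  obtain ⟨s, hs⟩ := exists_seq Q θ
    (by
      rintro α s t x hst ⟨h1, h2, h3, h4, h5, h6⟩
      exact ⟨h1, fun β hβ => hst β hβ ▸ h2 β hβ, h3, h4, h5, h6⟩)
    (by
      intro α hα s hs
      have hmono : ∀ β γ, β ≤ γ → γ < α →
          K.le (s β).1 (s γ).1 ∧ ∀ z ∈ (M β).carrier, (s γ).2 z = (s β).2 z := fun β γ hβγ hγ => by
        rcases hβγ.eq_or_lt with rfl | h
        · exact ⟨K.refl (hs _ hγ).2.2.1, fun _ _ => rfl⟩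
        · exact (hs γ hγ).2.1 β h
      have hs0 : 0 < α → s 0 = (E₀, f₀) := fun h => (hs 0 h).1 rfl
      rcases Ordinal.zero_or_succ_or_isSuccLimit α with rfl | ⟨β, rfl⟩ | hl
      · exact ⟨(E₀, f₀), fun _ => rfl, fun β hβ => absurd hβ not_lt_bot, hE₀.1, fun _ => hE₀, hf₀,
          fun β hβ => absurd hβ.symm (succ_ne_bot β)⟩
      · have hβ : β < succ β := lt_succ β
        have hβθ := hβ.trans_le hα
        obtain ⟨-, -, -, h4, h5, -⟩ := hs β hβ
        have hE₀β : K.le E₀ (s β).1 := by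
          have := (hmono 0 β zero_le hβ).1
          rwa [hs0 (hβ.bot_lt)] at this
        obtain ⟨E', f', k1, k2, k3, k4, k5⟩ := hstep β hβθ (s β).1 (s β).2 hE₀β
          (h4 (hθ β hβθ)) h5
        refine ⟨(E', f'), fun h => absurd h (succ_ne_bot β), fun γ hγ => ?_, k2.1, fun _ => k2, k3,
          fun γ hγ => succ_injective hγ ▸ k5⟩
        obtain ⟨e1, e2⟩ := hmono γ β (lt_succ_iff.1 hγ) hβ
        refine ⟨K.trans e1 k1, fun z hz => (k4 z ?_).trans (e2 z hz)⟩
        exact le_subset (hM.mono γ β (lt_succ_iff.1 hγ) hβθ.le) hz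
      · obtain ⟨U, hU⟩ := Model.exists_isUnion (fun β => (s β).1) hl.bot_lt
          fun β γ h h' => K.isSubmodel (hmono β γ h h').1
        obtain ⟨hU1, hU2⟩ := K.union α _ U hl.bot_lt (fun β γ h h' => (hmono β γ h h').1) hU
        let f := glue (fun β => (M β).carrier) α fun β => (s β).2
        have hf : ∀ β < α, ∀ x ∈ (M β).carrier, f x = (s β).2 x := fun β hβ x hx =>
          glue_eq (S := fun β => (M β).carrier) (fun γ γ' h h' => (hmono γ γ' h.le h').2) hβ hx
        refine ⟨(U, f), fun h => absurd (h ▸ hl) Ordinal.not_isSuccLimit_zero,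
          fun β hβ => ⟨hU2 β hβ, hf β hβ⟩, hU1, fun hc => ⟨hU1, le_antisymm ?_ ?_⟩, ?_,
          fun β hβ => absurd (hβ ▸ hl) (not_isSuccLimit_succ β)⟩
        · rw [hU.2]
          refine mk_biUnion_le (S := fun β => (s β).1.carrier) hν hc fun β hβ => ?_
          exact ((hs β hβ).2.2.2.1 ((Ordinal.card_le_card hβ.le).trans hc)).2.le
        · have := hU2 0 hl.bot_lt
          simp only [hs0 hl.bot_lt] at this
          rw [← hE₀.2]
          exact mk_le_of_le this
        · exact embOn_limit hl ⟨fun a b h h' => hM.mono a b h (h'.trans hα),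
            fun γ hγ => hM.cont γ (hγ.trans hα)⟩ fun β hβ =>
              ((hs β hβ).2.2.2.2.1.trans_le (hU2 β hβ)).congr fun x hx => (hf β hβ x hx).symm)
  have hcoh : ∀ β ≤ θ, K.le (s β).1 (s θ).1 ∧ ∀ z ∈ (M β).carrier, (s θ).2 z = (s β).2 z := by
    intro β hβ
    rcases hβ.eq_or_lt with rfl | h
    · exact ⟨K.refl (hs _ le_rfl).2.2.1, fun _ _ => rfl⟩
    · exact (hs θ le_rfl).2.1 β h
  have h0 : s 0 = (E₀, f₀) := (hs 0 zero_le).1 rfl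
  refine ⟨(s θ).1, (s θ).2, ?_, (hs θ le_rfl).2.2.2.2.1, fun x hx => ?_, fun α hα => ?_⟩
  · simpa [h0] using (hcoh 0 zero_le).1
  · simpa [h0] using (hcoh 0 zero_le).2 x hx
  · refine hR α _ _ (fun x hx => ((hcoh (succ α) (succ_le_of_lt hα)).2 x hx).symm) ?_
    exact (hs _ (succ_le_of_lt hα)).2.2.2.2.2 α rfl

/-! ### Universal and saturated models -/

/-- `N` is universal over `M` for the extensions of `M` in `K_ν`. -/
def UniversalOver (K : AEC L) (ν : Cardinal.{u}) (M N : Model L) : Prop :=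
  K.le M N ∧ ∀ E : Model L, K.memCard ν E → K.le M E →
    ∃ g : K.Emb E N, ∀ (m : ZFSet.{u}) (hm : m ∈ E.carrier), m ∈ M.carrier → g ⟨m, hm⟩ = m

/-- `N` is the union of a chain of length `ν` in which each stage realizes all types over the
preceding one. To embed a given `E₀` over `M`, all of `N` is mapped over `M` into a growing
extension of `E₀`, so that the `α`-th element of `E₀` enters the image at step `α`. In the end `E₀`
lies in the image, and the inverse map embeds it into `N`. -/
theorem exists_universalOver {ν : Cardinal.{u}} (hν : K.LST ≤ ν) (hAP : K.Amalgamation ν)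
    (hst : K.Stable ν) {M : Model L} (hM : K.memCard ν M) :
    ∃ N : Model L, K.memCard ν N ∧ UniversalOver K ν M N := by
  have hν0 := aleph0_le_of_lst hν
  have hc : ∀ α < ν.ord, α.card ≤ ν := fun α hα => (Cardinal.lt_ord.1 hα).le
  obtain ⟨X, hX0, hX, hXc, -, hXR⟩ := exists_chain (K := K) hν0 ν.ord hc (fun _ => True)
    (fun _ X X' => RealizesTypes K ν X X') M hM trivial
    (fun α _ X hX _ => by
      obtain ⟨N, hN, h⟩ := exists_realizesTypes hν hAP hst hX
      exact ⟨N, h.1, hN, trivial, h⟩)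
    (fun _ _ _ _ _ _ => trivial)
  have hXc' : ∀ α ≤ ν.ord, K.memCard ν (X α) := fun α hα =>
    hXc α hα ((Ordinal.card_le_card hα).trans (by simp))
  refine ⟨X ν.ord, hXc' _ le_rfl, hX0 ▸ IsContChain.le_last hX zero_le, fun E₀ hE₀ hME₀ => ?_⟩
  have hE₀ne : E₀.carrier.Nonempty := by
    rw [← Set.nonempty_coe_sort, ← Cardinal.mk_ne_zero_iff, hE₀.2]
    simpa using (Cardinal.aleph0_pos.trans_le hν0).ne'
  obtain ⟨a, ha, haS⟩ := exists_enum hE₀ne hE₀.2.le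
  obtain ⟨E, f, hE, hf, hf0, hfR⟩ := exists_lift hν0 ν.ord hc hX hE₀ (embOn_id (hX0 ▸ hME₀))
    (fun α f => ∃ x ∈ (X (succ α)).carrier, f x = a α)
    (fun α f f' h ⟨x, hx, hfx⟩ => ⟨x, hx, h x hx ▸ hfx⟩)
    (by
      rintro α hα E f hE₀E hE ⟨g, hg⟩
      -- After renaming, `X α` lies in `E₁`, and the type of `a α` over `X α` is realized by some
      -- `c` in the next stage; amalgamating along this equality of types lets `f'` send `c` to `a
      -- α`.
      obtain ⟨E₁, hE₁, φ, hφ⟩ := g.exists_copy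
      obtain ⟨hle, hreal⟩ := hXR α hα
      obtain ⟨c, hc⟩ := hreal E₁ hE₁ (hE.iso φ) (φ ⟨a α, le_subset hE₀E (ha α)⟩)
      obtain ⟨G, hG, k, hGc, hk, hkc⟩ := exists_amalgam_of_tp_eq hν hAP (hXc' α hα.le)
        (hXc' _ (succ_le_of_lt hα)) (hE.iso φ) hc.symm
      obtain ⟨G', hG', ρ, hρ⟩ := (Emb.ofIso φ hG).exists_copy
      obtain ⟨f', hf', hf'k⟩ := ((Emb.ofIso ρ (K.refl (K.le_mem hG').2)).comp k).exists_embOn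
      refine ⟨G', f', hG', hGc.iso ρ, hf', fun x hx => ?_, c, c.2, ?_⟩
      · have e := hf'k (incl hle ⟨x, hx⟩)
        rw [Emb.comp_apply, Emb.ofIso_val] at e
        refine e.trans ?_
        rw [show f x = (g ⟨x, hx⟩ : ZFSet.{u}) from (hg ⟨x, hx⟩).symm, ← hρ (g ⟨x, hx⟩)]
        congr 2
        exact Subtype.ext ((hk ⟨x, hx⟩).trans (hφ ⟨x, hx⟩).symm)
      · rw [hf'k, Emb.comp_apply, Emb.ofIso_val]
        refine Eq.trans ?_ (hρ ⟨a α, le_subset hE₀E (ha α)⟩)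
        congr 2
        exact Subtype.ext hkc)
  obtain ⟨g, hg⟩ := hf
  obtain ⟨E', hE', ψ, hψ⟩ := g.exists_image
  have hsub : E₀.carrier ⊆ E'.carrier := fun y hy => by
    obtain ⟨i, hi, rfl⟩ := haS y hy
    obtain ⟨x, hx, hfx⟩ := hfR i hi
    have hx' := le_subset (IsContChain.le_last hX (succ_le_of_lt hi)) hx
    rw [← hfx, ← hg ⟨x, hx'⟩, ← hψ]
    exact Subtype.prop _
  have hle : K.le E₀ E' := le_of_subset hE hE' hsub
  refine ⟨(Emb.ofIso ψ.symm (K.refl (hXc' _ le_rfl).1)).comp (incl hle), fun m hm hmM => ?_⟩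
  rw [Emb.comp_apply, Emb.ofIso_val]
  have hmX : m ∈ (X ν.ord).carrier :=
    le_subset (IsContChain.le_last hX zero_le) (hX0.symm ▸ hmM)
  have : incl hle ⟨m, hm⟩ = ψ ⟨m, hmX⟩ := Subtype.ext (by
    rw [hψ, hg]
    exact (hf0 m (hX0.symm ▸ hmM)).symm)
  rw [this, ψ.symm_apply_apply]

/-- Amalgamation of a model in `K_μ` with one in `K_{μ⁺}`, over a model in `K_μ`. -/
theorem exists_amalgam_succ {μ : Cardinal.{u}} (hμ : K.LST ≤ μ) (hAP : K.Amalgamation μ)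
    {C C' M : Model L} (hC : K.memCard μ C) (hC' : K.memCard μ C') (hM : K.memCard (succ μ) M)
    (hCC' : K.le C C') (hCM : K.le C M) :
    ∃ (E : Model L) (_ : K.le M E) (k : K.Emb C' E), K.memCard (succ μ) E ∧
      ∀ c : C, (k (incl hCC' c) : ZFSet.{u}) = c := by
  have hμ0 := aleph0_le_of_lst hμ
  have hμ' : ℵ₀ ≤ Cardinal.lift.{u + 1} μ := by simpa using hμ0
  have hμs : K.LST ≤ succ μ := hμ.trans (le_succ μ)
  have hne : M.carrier.Nonempty := by
    rw [← Set.nonempty_coe_sort, ← Cardinal.mk_ne_zero_iff, hM.2]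
    simp
  obtain ⟨a, ha, haS⟩ := exists_enum hne hM.2.le
  -- `M` is resolved into a chain of models in `K_μ` starting at `C`. Lifting this chain along `C ≤
  -- C'` needs amalgamation in `K_μ` only.
  obtain ⟨X, hX0, hX, hXc, hXI, hXR⟩ := exists_chain (K := K) hμ0 (succ μ).ord
    (fun α hα => card_le_of_lt_ord_succ hα) (fun X => K.le X M) (fun α _ X' => a α ∈ X'.carrier)
    C hC hCM
    (by
      intro α _ X hX hXM
      obtain ⟨X', h1, h2, h3⟩ := exists_le_of_lst hμ hM.1 (Z := insert (a α) X.carrier)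
        (Set.insert_subset (ha α) (le_subset hXM))
        ((Cardinal.mk_insert_le).trans
          (Cardinal.add_le_of_le hμ' hX.2.le (Cardinal.one_le_aleph0.trans hμ')))
        (hX.2 ▸ mk_le_of_le hXM)
      exact ⟨X', le_of_subset hXM h1 ((Set.subset_insert _ _).trans h2), h3, h1,
        h2 (Set.mem_insert _ _)⟩)
    (fun δ _ hl A hA hI => K.smooth δ A M hl hA hI)
  have hXM : X (succ μ).ord = M := eq_of_le_of_subset (hXI _ le_rfl) fun y hy => by
    obtain ⟨i, hi, rfl⟩ := haS y hy
    exact le_subset (IsContChain.le_last hX (succ_le_of_lt hi)) (hXR i hi)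
  have hXc' : ∀ α < (succ μ).ord, K.memCard μ (X α) := fun α hα =>
    hXc α hα.le (card_le_of_lt_ord_succ hα)
  obtain ⟨G, f, hG, hf, hf0, -⟩ := exists_lift hμ0 (succ μ).ord
    (fun α hα => card_le_of_lt_ord_succ hα) hX hC' (embOn_id (hX0.symm ▸ hCC'))
    (fun _ _ => True) (fun _ _ _ _ _ => trivial)
    (by
      rintro α hα E f - hE ⟨g, hg⟩
      have hs : succ α < (succ μ).ord :=
        (isSuccLimit_ord (hμ0.trans (le_succ μ))).succ_lt hα
      obtain ⟨D, hD, k, hDc, hk⟩ := hAP.exists_extension (hXc' α hα) (hXc' _ hs) hE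
        (incl (hX.mono α _ (le_succ α) hs.le)) g
      obtain ⟨f', hf', hf'k⟩ := k.exists_embOn
      refine ⟨D, f', hD, hDc, hf', fun x hx => ?_, trivial⟩
      exact (hf'k (incl (hX.mono α _ (le_succ α) hs.le) ⟨x, hx⟩)).trans
        ((hk ⟨x, hx⟩).trans (hg ⟨x, hx⟩)))
  rw [hXM] at hf
  obtain ⟨g, hg⟩ := hf
  have hG' : K.mem G := (K.le_mem hG).2
  -- The size of the lifted target is not controlled, so it is cut down to a model in `K_{μ⁺}`.
  obtain ⟨G₀, hG₀, hsub, hc⟩ := exists_le_of_lst hμs hG'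
    (Z := (Set.range fun m => (g m : ZFSet.{u})) ∪ C'.carrier)
    (Set.union_subset (by rintro _ ⟨b, rfl⟩; exact (g b).2) (le_subset hG))
    ((Cardinal.mk_union_le _ _).trans
      (Cardinal.add_le_of_le (Cardinal.aleph0_le_lift.2 (hμ0.trans (le_succ μ))) (mk_range_emb_le hM g)
        (hC'.2.le.trans (Cardinal.lift_le.2 (le_succ μ)))))
    (hM.2 ▸ mk_le_of_emb g)
  obtain ⟨g', hg'⟩ := g.exists_codRestrict hG₀ fun b => hsub (Or.inl ⟨b, rfl⟩)
  have hC'G₀ : K.le C' G₀ := le_of_subset hG hG₀ (Set.subset_union_right.trans hsub)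
  obtain ⟨E, hE, φ, hφ⟩ := g'.exists_copy
  refine ⟨E, hE, (Emb.ofIso φ (K.refl (K.le_mem hE).2)).comp (incl hC'G₀), hc.iso φ, fun c => ?_⟩
  rw [Emb.comp_apply, Emb.ofIso_val]
  refine Eq.trans ?_ (hφ (incl hCM c))
  congr 2
  refine Subtype.ext ((hg' _).trans ((hg _).trans (hf0 c (hX0.symm ▸ c.2)))).symm

/-- Every model in `K_{μ⁺}` has an extension in `K_{μ⁺}` which is saturated for models in `K_μ`. -/
theorem exists_saturated {μ : Cardinal.{u}} (hμ : K.LST ≤ μ) (hAP : K.Amalgamation μ)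
    (hAP' : K.Amalgamation (succ μ)) (hst : K.Stable (succ μ)) {M : Model L}
    (hM : K.memCard (succ μ) M) :
    ∃ N : Model L, K.le M N ∧ K.memCard (succ μ) N ∧ ∀ (C C' : Model L) (hCC' : K.le C C'),
      K.memCard μ C → K.memCard μ C' → K.le C N →
        ∃ g : K.Emb C' N, ∀ c : C, (g (incl hCC' c) : ZFSet.{u}) = c := by
  have hμ0 := aleph0_le_of_lst hμ
  have hμs : K.LST ≤ succ μ := hμ.trans (le_succ μ)
  have hs0 : ℵ₀ ≤ succ μ := hμ0.trans (le_succ μ)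
  -- Universal extensions are iterated `μ⁺` times. By regularity a submodel `C` in `K_μ` of the
  -- union lies in some `X α`; the amalgam of `C'` and `X α` over `C` then embeds in the next stage
  -- over `X α`.
  obtain ⟨X, hX0, hX, hXc, -, hXR⟩ := exists_chain (K := K) hs0 (succ μ).ord
    (fun α hα => (Cardinal.lt_ord.1 hα).le) (fun _ => True)
    (fun _ X X' => UniversalOver K (succ μ) X X') M hM trivial
    (fun α _ X hX _ => by
      obtain ⟨N, hN, h⟩ := exists_universalOver hμs hAP' hst hX
      exact ⟨N, h.1, hN, trivial, h⟩)
    (fun _ _ _ _ _ _ => trivial)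
  have hXc' : ∀ α ≤ (succ μ).ord, K.memCard (succ μ) (X α) := fun α hα =>
    hXc α hα ((Ordinal.card_le_card hα).trans (by simp))
  have hl := isSuccLimit_ord hs0
  refine ⟨X (succ μ).ord, hX0 ▸ IsContChain.le_last hX zero_le, hXc' _ le_rfl,
    fun C C' hCC' hC hC' hCN => ?_⟩
  obtain ⟨α, hα, hCα⟩ := exists_subset_of_chain hμ0 (S := fun α => (X α).carrier)
    (fun α β h h' => le_subset (hX.mono α β h h'.le)) hC.2.le
    (fun x hx => (hX.cont _ le_rfl hl).mem_iff.1 (le_subset hCN hx))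
  have hCX : K.le C (X α) := le_of_subset hCN (IsContChain.le_last hX hα.le) hCα
  obtain ⟨E, hE, k, hEc, hk⟩ := exists_amalgam_succ hμ hAP hC hC' (hXc' α hα.le) hCC' hCX
  obtain ⟨g, hg⟩ := (hXR α hα).2 E hEc hE
  refine ⟨((incl (IsContChain.le_last hX (succ_le_of_lt hα))).comp g).comp k, fun c => ?_⟩
  rw [Emb.comp_apply, Emb.comp_apply, incl_val]
  have : k (incl hCC' c) = ⟨c, le_subset hE (hCα c.2)⟩ := Subtype.ext (hk c)
  rw [this]
  exact hg _ _ (hCα c.2)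

end AEC

end AECFrame

namespace AECFrame

open Order

variable {L : FirstOrder.Language.{u, u}}

/-! ### Diamond -/

/-- The points below a regular cardinal that are closed under a function are unbounded. -/
theorem exists_closed_point {κ : Cardinal.{u}} (hκ : κ.IsRegular) (hκ' : ℵ₀ < κ)
    {F : Ordinal.{u} → Ordinal.{u}} (hF : ∀ α < κ.ord, F α < κ.ord) {β : Ordinal.{u}}
    (hβ : β < κ.ord) : ∃ γ < κ.ord, β ≤ γ ∧ ∀ α < γ, F α < γ := by
  -- `G β` strictly bounds `F` below `β`, so the supremum of the iterates of `G` is closed under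
  -- `F`; uncountable cofinality keeps it below `κ`.
  let G : Ordinal.{u} → Ordinal.{u} := fun β => sSup ((fun α => F α + 1) '' Set.Iio β)
  have hG : ∀ β < κ.ord, G β < κ.ord := by
    intro β hβ
    refine Ordinal.sSup_lt_of_lt_cof ?_ ?_
    · rw [← Ordinal.lift_cof, hκ.cof_ord]
      have h1 : #((fun α => F α + 1) '' Set.Iio β) ≤ Cardinal.lift.{u + 1} β.card := by
        refine Cardinal.mk_image_le.trans ?_
        rw [Cardinal.mk_Iio_ordinal]
      have h2 := h1.trans_lt (Cardinal.lift_lt.2 (Cardinal.lt_ord.1 hβ))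
      exact h2
    · rintro _ ⟨α, hα, rfl⟩
      exact (isSuccLimit_ord hκ'.le).succ_lt (hF α (lt_trans hα hβ))
  have hFG : ∀ α β, α < β → F α < G β := fun α β h =>
    (lt_succ (F α)).trans_le (le_csSup Ordinal.bddAbove_of_small ⟨α, h, rfl⟩)
  refine ⟨Ordinal.nfp G β, Ordinal.nfp_lt_ord (by rwa [hκ.cof_ord]) hG hβ, Ordinal.le_nfp G β,
    fun α hα => ?_⟩
  obtain ⟨n, hn⟩ := Ordinal.lt_nfp_iff.1 hα
  refine (hFG α _ hn).trans_le ?_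
  rw [← Function.iterate_succ_apply' G]
  exact Ordinal.iterate_le_nfp G β (n + 1)

/-- Diamond, in terms of ordinals: the guesses are right at some limit ordinal which is closed
under a given function. -/
theorem Diamond.exists_guess {μ : Cardinal.{u}} (hμ : ℵ₀ ≤ μ) (h : Diamond (succ μ)) :
    ∃ Δ : Ordinal.{u} → Set Ordinal.{u}, ∀ (X : Set Ordinal.{u}) (F : Ordinal.{u} → Ordinal.{u}),
      (∀ α < (succ μ).ord, F α < (succ μ).ord) →
        ∃ δ < (succ μ).ord, IsSuccLimit δ ∧ (∀ α < δ, F α < δ) ∧ X ∩ Set.Iio δ = Δ δ := by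
  obtain ⟨D, -, hD⟩ := h
  have hreg := Cardinal.isRegular_succ hμ
  have hlim := isSuccLimit_ord (hμ.trans (le_succ μ))
  let o : (succ μ).ord.ToType ≃o Set.Iio (succ μ).ord := Ordinal.ToType.mk.symm
  refine ⟨fun δ => {α | ∃ a d, (o a : Ordinal.{u}) = α ∧ (o d : Ordinal.{u}) = δ ∧ a ∈ D d},
    fun X F hF => ?_⟩
  -- Closure under the successor, together with positivity, makes every point of this club a limit
  -- ordinal.
  let T : Set (succ μ).ord.ToType :=
    {a | 0 < (o a : Ordinal.{u}) ∧ ∀ α < (o a : Ordinal.{u}), max (F α) (succ α) < o a}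
  have hF' : ∀ α < (succ μ).ord, max (F α) (succ α) < (succ μ).ord := fun α hα =>
    max_lt (hF α hα) (hlim.succ_lt hα)
  have hT : IsClub T := by
    refine ⟨fun d hd hne _ a ha => ?_, fun a => ?_⟩
    · obtain ⟨c, hc⟩ := hne
      refine ⟨(hd hc).1.trans_le (o.monotone (ha.1 hc)), fun α hα => ?_⟩
      let α' : (succ μ).ord.ToType := o.symm ⟨α, hα.trans (o a).2⟩
      have hα' : (o α' : Ordinal.{u}) = α := by simp [α']
      have hlt : α' < a := by
        rw [← o.lt_iff_lt, ← Subtype.coe_lt_coe, hα']; exact hα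
      obtain ⟨e, he, hαe⟩ := (lt_isLUB_iff ha).1 hlt
      have hle : (o e : Ordinal.{u}) ≤ o a := o.monotone (ha.1 he)
      refine ((hd he).2 α ?_).trans_le hle
      rw [← hα']
      exact o.lt_iff_lt.2 hαe
    · obtain ⟨γ, hγ, hle, hcl⟩ := exists_closed_point hreg (hμ.trans_lt (lt_succ μ)) hF'
        (hlim.succ_lt (Set.mem_Iio.1 (o a).2))
      refine ⟨o.symm ⟨γ, hγ⟩, ⟨?_, ?_⟩, ?_⟩
      · simpa using (bot_lt_succ (o a : Ordinal.{u})).trans_le hle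
      · simpa using hcl
      · rw [← o.le_iff_le, ← Subtype.coe_le_coe]
        simpa using (le_succ _).trans hle
  obtain ⟨d, hd, hdT⟩ := hD {a | (o a : Ordinal.{u}) ∈ X} hT
  have hδ : IsSuccLimit (o d : Ordinal.{u}) := by
    rw [Ordinal.isSuccLimit_iff, isSuccPrelimit_iff_succ_lt]
    exact ⟨hdT.1.ne', fun α hα => (le_max_right _ _).trans_lt (hdT.2 α hα)⟩
  refine ⟨o d, (o d).2, hδ, fun α hα => (le_max_left _ _).trans_lt (hdT.2 α hα), ?_⟩
  ext α
  constructor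
  · rintro ⟨hα, hαd⟩
    let a : (succ μ).ord.ToType := o.symm ⟨α, lt_trans (Set.mem_Iio.1 hαd) (Set.mem_Iio.1 (o d).2)⟩
    have ha : (o a : Ordinal.{u}) = α := by simp [a]
    refine ⟨a, d, ha, rfl, ?_⟩
    rw [← hd]
    refine ⟨?_, ?_⟩
    · simpa [ha] using hα
    · rw [Set.mem_Iio, ← o.lt_iff_lt, ← Subtype.coe_lt_coe, ha]; exact hαd
  · rintro ⟨a, d', rfl, hd', ha⟩
    obtain rfl : d' = d := o.injective (Subtype.ext hd')
    rw [← hd] at ha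
    exact ⟨ha.1, o.lt_iff_lt.2 ha.2⟩

/-! ### The non-splitting frame -/

namespace AEC

variable {K : AEC L} {A B C D : Model L} {μ : Cardinal.{u}}

/-- Equality of types is preserved by isomorphisms. -/
theorem tp_eq_of_iso {M N Z G Z' G' : Model L} (σ : N ≃[L] M) {hZ : K.le N Z} {hG : K.le N G}
    {z : Z} {g : G} (h : tp hZ z = tp hG g) (hZ' : K.le M Z') (hG' : K.le M G')
    (φ : Z ≃[L] Z') (hφ : ∀ n, (φ (incl hZ n) : ZFSet.{u}) = σ n) (χ : G ≃[L] G')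
    (hχ : ∀ n, (χ (incl hG n) : ZFSet.{u}) = σ n) : tp hZ' (φ z) = tp hG' (χ g) := by
  -- Every pointed extension of `N` gets a chosen copy over `M` along `σ`. Copying respects atomic
  -- equivalence (`key`), and any other copy realizes the same type (`h1`), so `σ` acts on types.
  have hcopy : ∀ P : K.Pointed N, ∃ (H : Model L) (_ : K.le M H) (ρ : P.model ≃[L] H),
      ∀ n, (ρ (incl P.le n) : ZFSet.{u}) = σ n := by
    intro P
    obtain ⟨H, hH, ρ, hρ⟩ := (Emb.ofIso σ.symm P.le).exists_copy
    refine ⟨H, hH, ρ, fun n => ?_⟩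
    rw [← hρ (σ n)]
    congr 2
    exact Subtype.ext (by simp)
  choose H hH ρ hρ using hcopy
  have key : ∀ P Q : K.Pointed N, Pointed.Rel K P Q →
      tp (hH P) (ρ P P.pt) = tp (hH Q) (ρ Q Q.pt) := by
    rintro P Q ⟨E, f, g, hfg, hpt⟩
    refine Quot.sound ⟨E, f.comp (Emb.ofIso (ρ P).symm (K.refl (K.le_mem P.le).2)),
      g.comp (Emb.ofIso (ρ Q).symm (K.refl (K.le_mem Q.le).2)), fun m => ?_, ?_⟩
    · have e : ∀ P, Emb.ofIso (ρ P).symm (K.refl (K.le_mem P.le).2) (incl (hH P) m) =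
          incl P.le (σ.symm m) := fun P => by
        have e : incl (hH P) m = ρ P (incl P.le (σ.symm m)) := Subtype.ext (by rw [hρ]; simp)
        refine Subtype.ext ?_
        rw [e, Emb.ofIso_val, FirstOrder.Language.Equiv.symm_apply_apply]
      rw [Emb.comp_apply, Emb.comp_apply, e, e]
      exact hfg _
    · have e : ∀ P, Emb.ofIso (ρ P).symm (K.refl (K.le_mem P.le).2) (ρ P P.pt) = P.pt := fun P =>
        Subtype.ext (by rw [Emb.ofIso_val]; simp)
      rw [Emb.comp_apply, Emb.comp_apply, e, e]
      exact hpt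
  have h1 : ∀ (P : K.Pointed N) (Y : Model L) (hY : K.le M Y) (τ : P.model ≃[L] Y),
      (∀ n, (τ (incl P.le n) : ZFSet.{u}) = σ n) → tp (hH P) (ρ P P.pt) = tp hY (τ P.pt) := by
    intro P Y hY τ hτ
    have := tp_eq_of_emb (hH P) hY (Emb.ofIso (τ.comp (ρ P).symm) (K.refl (K.le_mem hY).2))
      (fun m => ?_) (ρ P P.pt)
    · rw [this]
      congr 1
      refine Subtype.ext ?_
      simp
    · have e : incl (hH P) m = ρ P (incl P.le (σ.symm m)) := Subtype.ext (by rw [hρ]; simp)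
      rw [e, Emb.ofIso_val, FirstOrder.Language.Equiv.comp_apply,
        FirstOrder.Language.Equiv.symm_apply_apply, hτ]
      simp
  have h2 := congrArg (Quot.lift (fun P : K.Pointed N => tp (hH P) (ρ P P.pt)) key) h
  rw [← h1 ⟨Z, hZ, z⟩ Z' hZ' φ hφ, ← h1 ⟨G, hG, g⟩ G' hG' χ hχ]
  exact h2

/-- Non-splitting is preserved by isomorphisms. -/
theorem doesNotSplit_of_iso {C₁ C' Z E : Model L} {hZ : K.le C₁ Z} {hE : K.le C' E} {z : Z}
    (φ : Z ≃[L] E) (ψ : C₁ ≃[L] C') (hφψ : ∀ c, (φ (incl hZ c) : ZFSet.{u}) = ψ c)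
    (hCC₁ : K.le C C₁) (hψ : ∀ c : C, (ψ (incl hCC₁ c) : ZFSet.{u}) = c)
    (h : (tp hZ z).DoesNotSplit μ C) : (tp hE (φ z)).DoesNotSplit μ C := by
  intro M₁ M₂ hM₁ hM₂ f hA₁ h₁ hA₂ h₂ hf
  -- The test models and the isomorphism between them are pulled back into `C₁`; the witness found
  -- there is pushed forward again.
  obtain ⟨N₁, hN₁, ψ₁, hψ₁⟩ := exists_image_iso ψ.symm h₁
  obtain ⟨N₂, hN₂, ψ₂, hψ₂⟩ := exists_image_iso ψ.symm h₂
  have hback : ∀ {M N : Model L} (hM : K.le M C') (hN : K.le N C₁) (χ : M ≃[L] N),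
      (∀ a, (χ a : ZFSet.{u}) = ψ.symm (incl hM a)) → ∀ n : N,
        (φ (incl (K.trans hN hZ) n) : ZFSet.{u}) = χ.symm n := by
    intro M N hM hN χ hχ n
    have e : incl hN n = ψ.symm (incl hM (χ.symm n)) := Subtype.ext (by
      rw [← hχ]; simp)
    refine (hφψ (incl hN n)).trans ?_
    rw [e, FirstOrder.Language.Equiv.apply_symm_apply, incl_val]
  have hfix : ∀ {M N : Model L} (hM : K.le M C') (χ : M ≃[L] N) (hCM : K.le C M),
      (∀ a, (χ a : ZFSet.{u}) = ψ.symm (incl hM a)) → ∀ c : C,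
        (χ (incl hCM c) : ZFSet.{u}) = c := by
    intro M N hM χ hCM hχ c
    have e : incl hM (incl hCM c) = ψ (incl hCC₁ c) := Subtype.ext (hψ c).symm
    rw [hχ, e, FirstOrder.Language.Equiv.symm_apply_apply, incl_val]
  have hCN : ∀ {M N : Model L} (hM : K.le M C') (_ : K.le N C₁) (χ : M ≃[L] N) (_ : K.le C M),
      (∀ a, (χ a : ZFSet.{u}) = ψ.symm (incl hM a)) → K.le C N := by
    intro M N hM hN χ hCM hχ
    refine le_of_subset hCC₁ hN fun c hc => ?_
    have := hfix hM χ hCM hχ ⟨c, hc⟩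
    exact (show _ = c from this) ▸ Subtype.prop _
  obtain ⟨G₁, G₂, hG₁, hG₂, χ, b, hχ, hp, hq⟩ := h N₁ N₂ (hM₁.iso ψ₁) (hM₂.iso ψ₂)
    ((ψ₂.comp f).comp ψ₁.symm) (hCN h₁ hN₁ ψ₁ hA₁ hψ₁) hN₁ (hCN h₂ hN₂ ψ₂ hA₂ hψ₂) hN₂
    (fun c => by
      have e : incl (hCN h₁ hN₁ ψ₁ hA₁ hψ₁) c = ψ₁ (incl hA₁ c) :=
        Subtype.ext (hfix h₁ ψ₁ hA₁ hψ₁ c).symm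
      refine Subtype.ext ?_
      rw [e, FirstOrder.Language.Equiv.comp_apply, FirstOrder.Language.Equiv.symm_apply_apply,
        FirstOrder.Language.Equiv.comp_apply, hf, hfix h₂ ψ₂ hA₂ hψ₂, incl_val])
  obtain ⟨H₁, hH₁, ρ₁, hρ₁⟩ := (Emb.ofIso ψ₁ hG₁).exists_copy
  obtain ⟨H₂, hH₂, ρ₂, hρ₂⟩ := (Emb.ofIso ψ₂ hG₂).exists_copy
  have hρ : ∀ {M N G H : Model L} (ψ : M ≃[L] N) (hG : K.le N G) (ρ : G ≃[L] H),
      (∀ m, (ρ (Emb.ofIso ψ hG m) : ZFSet.{u}) = m) → ∀ n, (ρ (incl hG n) : ZFSet.{u}) = ψ.symm n := by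
    intro M N G H ψ hG ρ hρ n
    rw [← hρ]
    congr 2
    exact Subtype.ext (by simp)
  refine ⟨H₁, H₂, hH₁, hH₂, (ρ₂.comp χ).comp ρ₁.symm, ρ₁ b, fun x => ?_, ?_, ?_⟩
  · have e : incl hH₁ x = ρ₁ (incl hG₁ (ψ₁ x)) := Subtype.ext (by
      rw [hρ ψ₁ hG₁ ρ₁ hρ₁]; simp)
    refine Subtype.ext ?_
    rw [e, FirstOrder.Language.Equiv.comp_apply, FirstOrder.Language.Equiv.symm_apply_apply,
      FirstOrder.Language.Equiv.comp_apply, hχ, hρ ψ₂ hG₂ ρ₂ hρ₂]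
    simp
  · exact tp_eq_of_iso ψ₁.symm hp (K.trans h₁ hE) hH₁ φ (hback h₁ hN₁ ψ₁ hψ₁) ρ₁
      (hρ ψ₁ hG₁ ρ₁ hρ₁)
  · have e : ((ρ₂.comp χ).comp ρ₁.symm) (ρ₁ b) = ρ₂ (χ b) := by
      rw [FirstOrder.Language.Equiv.comp_apply, FirstOrder.Language.Equiv.symm_apply_apply,
        FirstOrder.Language.Equiv.comp_apply]
    rw [e]
    exact tp_eq_of_iso ψ₂.symm hq (K.trans h₂ hE) hH₂ φ (hback h₂ hN₂ ψ₂ hψ₂) ρ₂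
      (hρ ψ₂ hG₂ ρ₂ hρ₂)

/-- `NonForking` speaks of some realization of the type in `K_μ`. Its conditions depend on the type
alone, since equal types agree on being algebraic, so they can be tested on the given realization.
-/
theorem nonForking_iff (h : K.le B D) (hD : K.memCard μ D) (b : D) :
    (nonSplittingFrame K μ).NonForking A (tp h b) ↔ K.memCard μ A ∧ K.memCard μ B ∧ K.le A B ∧
      (b : ZFSet.{u}) ∉ B.carrier ∧ (tp h b).DoesNotSplit μ A := by
  constructor
  · rintro ⟨E, hE, c, hc, h1, h2, -, h4, -, h6, h7, h8⟩
    refine ⟨h1, h2, h4, fun hb => h6 ((mem_iff_of_tp_eq hc).1 hb), ?_⟩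
    rw [hc]
    exact h8
  · rintro ⟨h1, h2, h3, h4, h5⟩
    exact ⟨D, h, b, rfl, h1, h2, hD, h3, fun e => h4 (e ▸ b.2), h4, h, h5⟩

/-- The only model between `A` and itself is `A`, and an isomorphism fixing it pointwise is the
identity. This starts the chain of triples. -/
theorem doesNotSplit_self (h : K.le A B) (b : B) : (tp h b).DoesNotSplit μ A := by
  intro M₁ M₂ _ _ f hA₁ h₁ hA₂ h₂ hf
  obtain rfl := eq_of_le_of_subset hA₁ (le_subset h₁)
  obtain rfl := eq_of_le_of_subset hA₂ (le_subset h₂)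
  exact ⟨B, B, h, h, FirstOrder.Language.Equiv.refl L B, b, fun x => (congrArg (incl h) (hf x)).symm,
    rfl, rfl⟩

end AEC

end AECFrame

/-! ### Extending non-splitting triples at successor and limit stages -/

namespace AECFrame

open Order

variable {L : FirstOrder.Language.{u, u}}

namespace AEC

variable {K : AEC L} {A B C D N₀ N₁ : Model L} {μ : Cardinal.{u}} {b : ZFSet.{u}}

/-- `N` is saturated with respect to models in `K_μ`. -/
def SaturatedFor (K : AEC L) (μ : Cardinal.{u}) (N : Model L) : Prop :=
  ∀ (C C' : Model L) (hCC' : K.le C C'), K.memCard μ C → K.memCard μ C' → K.le C N →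
    ∃ g : K.Emb C' N, ∀ c : C, (g (incl hCC' c) : ZFSet.{u}) = c

/-- Saturation is stated for inclusions: replace `C` by its image in `N₀` and `C'` by a copy
extending that image. -/
theorem SaturatedFor.exists_embOn (hN : SaturatedFor K μ N₀) {C' : Model L} (hCC' : K.le C C')
    (hC : K.memCard μ C) (hC' : K.memCard μ C') {e : ZFSet.{u} → ZFSet.{u}}
    (he : EmbOn K C N₀ e) : ∃ e', EmbOn K C' N₀ e' ∧ ∀ x ∈ C.carrier, e' x = e x := by
  obtain ⟨g, hg⟩ := he
  obtain ⟨X, hX, ψ, hψ⟩ := g.exists_image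
  obtain ⟨Y, hY, φ, hφ⟩ := (Emb.ofIso ψ.symm hCC').exists_copy
  obtain ⟨k, hk⟩ := hN X Y hY (hC.iso ψ) (hC'.iso φ) hX
  obtain ⟨e', he', he'k⟩ := (k.comp (Emb.ofIso φ (K.refl (K.le_mem hY).2))).exists_embOn
  refine ⟨e', he', fun x hx => ?_⟩
  refine (he'k (incl hCC' ⟨x, hx⟩)).trans ?_
  rw [Emb.comp_apply]
  have h1 : Emb.ofIso φ (K.refl (K.le_mem hY).2) (incl hCC' ⟨x, hx⟩) = incl hY (ψ ⟨x, hx⟩) := by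
    refine Subtype.ext ?_
    rw [Emb.ofIso_val, incl_val, ← hφ (ψ ⟨x, hx⟩)]
    congr 2
    exact Subtype.ext (by simp)
  rw [h1, hk, hψ, hg]

/-- `(C, D, b)` is a triple in `K_μ` such that the type of `b` over `C` does not split over `A`. -/
def NonSplittingTriple (K : AEC L) (μ : Cardinal.{u}) (A C D : Model L) (b : ZFSet.{u}) : Prop :=
  K.memCard μ C ∧ K.memCard μ D ∧ ∃ (h : K.le C D) (hb : b ∈ D.carrier),
    (nonSplittingFrame K μ).NonForking A (tp h ⟨b, hb⟩)

theorem NonSplittingTriple.isBasicTriple (h : NonSplittingTriple K μ A C D b) :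
    (nonSplittingFrame K μ).IsBasicTriple μ C D b := by
  obtain ⟨hC, hD, hCD, hb, hnf⟩ := h
  have hbC := ((nonForking_iff hCD hD _).1 hnf).2.2.2.1
  exact ⟨hC, hD, fun e => hbC (e ▸ hb), hbC, hCD, hb, D, hCD, ⟨b, hb⟩, hbC, rfl⟩

/-- The graph of the restriction of `k` to `S`. -/
def graphOn (k : ZFSet.{u} → ZFSet.{u}) (S : Set ZFSet.{u}) : Set (ZFSet.{u} × ZFSet.{u}) :=
  {q | q.1 ∈ S ∧ k q.1 = q.2}

/-- A non-splitting triple which is not a uniqueness triple has an extension that defeats a given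
guess `Γ` for an embedding of `D` in `N₁`. -/
theorem NonSplittingTriple.exists_extension (hμ : ℵ₀ ≤ μ)
    (htrans : (nonSplittingFrame K μ).Transitivity μ) (hAC : K.le A C)
    (h : NonSplittingTriple K μ A C D b)
    (huq : ¬ (nonSplittingFrame K μ).IsUniquenessTriple μ C D b) (hN₀ : SaturatedFor K μ N₀)
    {e : ZFSet.{u} → ZFSet.{u}} (he : EmbOn K C N₀ e) {W : Set ZFSet.{u}}
    (hW : Cardinal.lift.{u + 1} μ < #W) (hDW : D.carrier ⊆ W)
    (Γ : Set (ZFSet.{u} × ZFSet.{u})) :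
    ∃ (C' D' : Model L) (e' : ZFSet.{u} → ZFSet.{u}), K.le C C' ∧ K.le D D' ∧ C ≠ C' ∧
      NonSplittingTriple K μ A C' D' b ∧ D'.carrier ⊆ W ∧ EmbOn K C' N₀ e' ∧
      (∀ x ∈ C.carrier, e' x = e x) ∧
      ∀ k, EmbOn K D' N₁ k → (∀ x ∈ C'.carrier, k x = e' x) → Γ ≠ graphOn k D.carrier := by
  have hbas := h.isBasicTriple
  obtain ⟨hC, hD, hCD, hb, hnf⟩ := h
  have hbC := hbas.2.2.2.1
  obtain ⟨C₁, hC₁, hne, hCD', hb', hCC₁, X, Y, hX, hY, fX, fY, hXc, hYc, amX, amY, hneq, htp, hnfX⟩ :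
      ∃ C₁, (nonSplittingFrame K μ).WitnessesNonUniqueness μ C D b C₁ := by
    by_contra hcon
    exact huq ⟨hbas, hcon⟩
  -- The embedding is extended to `C₁` before an amalgam is chosen, so that both candidates are
  -- tested against the same `e₁`.
  obtain ⟨e₁, he₁, he₁e⟩ := hN₀.exists_embOn hCC₁ hC hC₁ he
  obtain ⟨Z, hZ, f, hZc, hf, hnfZ, hΓ⟩ : ∃ (Z : Model L) (hZ : K.le C₁ Z) (f : K.Emb D Z),
      K.memCard μ Z ∧ (∀ c : C, (f (incl hCD c) : ZFSet.{u}) = c) ∧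
      (nonSplittingFrame K μ).NonForking C (tp hZ (f ⟨b, hb⟩)) ∧
      ∀ g : K.Emb Z N₁, (∀ c : C₁, (g (incl hZ c) : ZFSet.{u}) = e₁ c) →
        Γ ≠ {q | ∃ hq : q.1 ∈ D.carrier, (g (f ⟨q.1, hq⟩) : ZFSet.{u}) = q.2} := by
    have hX' : ∀ c : C, (fX (incl hCD c) : ZFSet.{u}) = c := fun c => congrArg Subtype.val (amX c)
    have hY' : ∀ c : C, (fY (incl hCD c) : ZFSet.{u}) = c := fun c => congrArg Subtype.val (amY c)
    by_contra hcon
    push Not at hcon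
    -- If neither candidate refutes `Γ`, then `gX` and `gY` agree on `C₁` by `e₁` and on `D` because
    -- both graphs are `Γ`. So `N₁` witnesses that the two amalgamations are equivalent.
    obtain ⟨gX, hgX, hΓX⟩ := hcon X hX fX hXc hX' hnfX
    obtain ⟨gY, hgY, hΓY⟩ := hcon Y hY fY hYc hY' (htp ▸ hnfX)
    refine hneq ⟨N₁, gX, gY, fun d => ?_, fun c => Subtype.ext ((hgX c).trans (hgY c).symm)⟩
    have hmem : ((d : ZFSet.{u}), (gX (fX d) : ZFSet.{u})) ∈ Γ := by
      rw [hΓX]; exact ⟨d.2, rfl⟩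
    rw [hΓY] at hmem
    obtain ⟨hq, hq'⟩ := hmem
    exact Subtype.ext hq'.symm
  -- As `W` has more than `μ` elements, removing `D` leaves room in `W` for the new elements of the
  -- amalgam.
  have hWD : #Z.carrier ≤ #(W \ D.carrier : Set ZFSet.{u}) := by
    rw [hZc.2]
    by_contra! hlt
    have hμ' : ℵ₀ ≤ Cardinal.lift.{u + 1} μ := by simpa using hμ
    have := Cardinal.mk_union_le (W \ D.carrier) D.carrier
    rw [Set.sdiff_union_of_subset hDW] at this
    exact absurd (this.trans (Cardinal.add_le_of_le hμ' hlt.le hD.2.le)) (not_le.2 hW)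
  obtain ⟨E, hDE, φ, hφ, hEW⟩ := f.exists_copy_in W hWD
  obtain ⟨C', hC'E, ψ, hψ⟩ := exists_image_iso φ hZ
  have hCC' : ∀ c : C, (ψ (incl hCC₁ c) : ZFSet.{u}) = c := fun c => by
    rw [hψ]
    refine Eq.trans ?_ (hφ (incl hCD c))
    congr 2
    exact Subtype.ext (hf c).symm
  have hle : K.le C C' := le_of_subset (K.trans hCD hDE) hC'E fun c hc =>
    (show _ = c from hCC' ⟨c, hc⟩) ▸ Subtype.prop _
  have hEc : K.memCard μ E := hZc.iso φ
  have hC'c : K.memCard μ C' := hC₁.iso ψ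
  have hφb : φ (f ⟨b, hb⟩) = incl hDE ⟨b, hb⟩ := Subtype.ext (hφ ⟨b, hb⟩)
  have hnfE : (nonSplittingFrame K μ).NonForking C (tp hC'E (incl hDE ⟨b, hb⟩)) := by
    obtain ⟨-, -, -, h4, h5⟩ := (nonForking_iff hZ hZc _).1 hnfZ
    rw [nonForking_iff hC'E hEc]
    refine ⟨hC, hC'c, hle, fun hbC' => h4 ?_, ?_⟩
    · have e : φ (f ⟨b, hb⟩) = φ (incl hZ (ψ.symm ⟨b, hbC'⟩)) := by
        rw [hφb]
        refine Subtype.ext ?_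
        rw [← hψ]
        simp
      rw [φ.injective e]
      exact (ψ.symm ⟨b, hbC'⟩).2
    · rw [← hφb]
      exact doesNotSplit_of_iso φ ψ (fun c => (hψ c).symm) hCC₁ hCC' h5
  -- The new type does not split over `C`, and its restriction to `C` does not split over `A`;
  -- transitivity joins the two.
  have hnfA : (nonSplittingFrame K μ).NonForking A (tp hC'E (incl hDE ⟨b, hb⟩)) := by
    refine htrans A C C' ((nonForking_iff hCD hD _).1 hnf).1 hC hC'c hAC hle _ hnfE ?_
    have := tp_eq_of_le hCD (K.trans hCD hDE) hDE ⟨b, hb⟩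
    rw [this] at hnf
    exact hnf
  obtain ⟨g₁, hg₁⟩ := he₁
  obtain ⟨e', he', he'g⟩ := (g₁.comp (Emb.ofIso ψ.symm (K.refl hC₁.1))).exists_embOn
  have he'ψ : ∀ c : C₁, e' (ψ c) = e₁ c := fun c => by
    rw [he'g, ← hg₁, Emb.comp_apply]
    congr 2
    exact Subtype.ext (by simp)
  refine ⟨C', E, e', hle, hDE, ?_, ⟨hC'c, hEc, hC'E, _, hnfA⟩,
    hEW.trans (Set.union_subset hDW subset_rfl), he', fun x hx => ?_, ?_⟩
  -- If `C' = C`, then `ψ` maps `C₁` into `C` while fixing `C` pointwise, so injectivity forces `C₁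
  -- = C`.
  · rintro rfl
    refine hne (eq_of_le_of_subset hCC₁ fun x hx => ?_)
    have : ψ ⟨x, hx⟩ = ψ (incl hCC₁ (ψ ⟨x, hx⟩)) := Subtype.ext (hCC' _).symm
    have := congrArg Subtype.val (ψ.injective this)
    rw [incl_val] at this
    exact (show x = _ from this) ▸ Subtype.prop _
  · rw [← he₁e x hx]
    refine Eq.trans ?_ (he'ψ (incl hCC₁ ⟨x, hx⟩))
    rw [hCC']
  · rintro k ⟨g, hg⟩ hke hΓk
    refine hΓ (g.comp (Emb.ofIso φ (K.refl hEc.1))) (fun c => ?_) (hΓk.trans ?_)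
    · rw [Emb.comp_apply, hg, Emb.ofIso_val, ← hψ, hke _ (Subtype.prop _), he'ψ]
    · have key : ∀ d : D, (g.comp (Emb.ofIso φ (K.refl hEc.1)) (f d) : ZFSet.{u}) = k d := fun d => by
        rw [Emb.comp_apply, hg, Emb.ofIso_val, hφ]
      ext q
      exact ⟨fun ⟨hq, hq'⟩ => ⟨hq, (key ⟨_, hq⟩).trans hq'⟩,
        fun ⟨hq, hq'⟩ => ⟨hq, (key ⟨_, hq⟩).symm.trans hq'⟩⟩

/-- Non-splitting triples are closed under unions of chains. -/
theorem NonSplittingTriple.of_union (hμ : ℵ₀ ≤ μ)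
    (hcont : (nonSplittingFrame K μ).Continuity μ) {δ : Ordinal.{u}} (hδ : IsSuccLimit δ)
    (hδμ : δ < (succ μ).ord) {X Y : Ordinal.{u} → Model L} {U V : Model L}
    (hX : ∀ β γ, β ≤ γ → γ < δ → K.le (X β) (X γ))
    (hXc : ∀ γ < δ, IsSuccLimit γ → (X γ).IsUnion X γ) (hU : U.IsUnion X δ)
    (hV : V.IsUnion Y δ) (hYV : ∀ β < δ, K.le (Y β) V) (hUV : K.le U V)
    (h : ∀ β < δ, NonSplittingTriple K μ (X 0) (X β) (Y β) b) :
    NonSplittingTriple K μ (X 0) U V b := by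
  have hcard : ∀ {S : Ordinal.{u} → Model L} {T : Model L}, T.IsUnion S δ → (K.le (S 0) T) →
      (∀ β < δ, K.memCard μ (S β)) → K.memCard μ T := by
    intro S T hT h0 hS
    refine ⟨(K.le_mem h0).2, le_antisymm ?_ ?_⟩
    · rw [hT.2]
      exact mk_biUnion_le (S := fun β => (S β).carrier) hμ (card_le_of_lt_ord_succ hδμ)
        fun β hβ => (hS β hβ).2.le
    · rw [← (hS 0 hδ.bot_lt).2]
      exact mk_le_of_le h0
  have hUX := K.union δ X U hδ.bot_lt hX hU
  have hUc : K.memCard μ U := hcard hU (hUX.2 0 hδ.bot_lt) fun β hβ => (h β hβ).1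
  have hVc : K.memCard μ V := hcard hV (hYV 0 hδ.bot_lt) fun β hβ => (h β hβ).2.1
  obtain ⟨-, -, h0, hb0, -⟩ := h 0 hδ.bot_lt
  have hb : b ∈ V.carrier := le_subset (hYV 0 hδ.bot_lt) hb0
  obtain ⟨Z, rfl, hZ, hZc⟩ := exists_isContChain hδ hX hXc hU
  refine ⟨hUc, hVc, hUV, hb, ?_⟩
  have hZ0 : Z 0 = X 0 := hZ 0 hδ.bot_lt
  have := hcont δ hδ hδμ Z hZc
    (fun α hα => by
      rcases hα.eq_or_lt with rfl | hα
      · exact hUc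
      · rw [hZ α hα]; exact (h α hα).1)
    (tp hUV ⟨b, hb⟩)
    (fun α hα => by
      rw [hZ0]
      obtain ⟨-, -, h1, hb1, h2⟩ := h α hα
      have key : ∀ (T : Model L) (hT : K.le T V), T = X α →
          (nonSplittingFrame K μ).NonForking (X 0) (tp hT ⟨b, hb⟩) := by
        rintro _ hT rfl
        rwa [tp_eq_of_le h1 hT (hYV α hα) ⟨b, hb1⟩] at h2
      exact key _ _ (hZ α hα))
  rw [hZ0] at this
  exact this.2

end AEC

end AECFrame

/-! ### The chain against the guesses, and the contradiction -/

namespace AECFrame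

open Order

variable {L : FirstOrder.Language.{u, u}}

namespace AEC

variable {K : AEC L} {A B N₀ N₁ : Model L} {μ : Cardinal.{u}} {b : ZFSet.{u}}

/-- A strictly increasing chain of length `μ⁺` in `K_μ` gains an element at each step, so its union
has size `μ⁺`. -/
theorem exists_memCard_succ (hμ : ℵ₀ ≤ μ) (hNMM : K.NoMaximalModel μ) (hA : K.memCard μ A) :
    ∃ M : Model L, K.memCard (succ μ) M ∧ K.le A M := by
  have hs0 : ℵ₀ ≤ succ μ := hμ.trans (le_succ μ)
  have hl := isSuccLimit_ord hs0
  obtain ⟨X, hX0, hX, hXc, -, hXR⟩ := exists_chain (K := K) hμ (succ μ).ord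
    (fun α hα => card_le_of_lt_ord_succ hα) (fun _ => True) (fun _ X X' => X ≠ X') A hA trivial
    (fun α _ X hX _ => by
      obtain ⟨Y, hY, hlt⟩ := hNMM X hX
      exact ⟨Y, hlt.1, hY, trivial, hlt.2⟩)
    (fun _ _ _ _ _ _ => trivial)
  have hle : K.le A (X (succ μ).ord) := hX0 ▸ IsContChain.le_last hX zero_le
  refine ⟨X (succ μ).ord, ⟨(K.le_mem hle).2, le_antisymm ?_ ?_⟩, hle⟩
  · rw [(hX.cont _ le_rfl hl).2]
    refine mk_biUnion_le (S := fun α => (X α).carrier) hs0 (by simp) fun α hα => ?_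
    exact (hXc α hα.le (card_le_of_lt_ord_succ hα)).2.le.trans (Cardinal.lift_le.2 (le_succ μ))
  · have := lift_le_mk_of_strict (S := fun α => (X α).carrier) (U := (X (succ μ).ord).carrier)
      (fun α β h h' => le_subset (hX.mono α β h h'.le))
      (fun α hα => le_subset (IsContChain.le_last hX hα.le)) hl
      (fun α hα he => hXR α hα
        (eq_of_le_of_subset (hX.mono α _ (le_succ α) (hl.succ_lt hα).le) he.superset))
    simpa using this

/-- If no non-splitting triple above `(A, B, b)` is a uniqueness triple, then there is a chain of
such triples of length `μ⁺` that defeats a given sequence `Γ` of guesses. -/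
theorem exists_defeating_chain (hμ : ℵ₀ ≤ μ)
    (htrans : (nonSplittingFrame K μ).Transitivity μ)
    (hcont : (nonSplittingFrame K μ).Continuity μ)
    (hAB : NonSplittingTriple K μ A A B b)
    (huq : ∀ C D, K.le A C → K.le B D → NonSplittingTriple K μ A C D b →
      ¬ (nonSplittingFrame K μ).IsUniquenessTriple μ C D b)
    (hN₀ : SaturatedFor K μ N₀) (hAN₀ : K.le A N₀) {W : Set ZFSet.{u}}
    (hW : Cardinal.lift.{u + 1} μ < #W) (hBW : B.carrier ⊆ W)
    (Γ : Ordinal.{u} → Set (ZFSet.{u} × ZFSet.{u})) :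
    ∃ (C D : Ordinal.{u} → Model L) (e : ZFSet.{u} → ZFSet.{u}),
      IsContChain K.le C (succ μ).ord ∧ IsContChain K.le D (succ μ).ord ∧
      K.le (C (succ μ).ord) (D (succ μ).ord) ∧ (D (succ μ).ord).carrier ⊆ W ∧
      EmbOn K (C (succ μ).ord) N₀ e ∧
      ∀ α < (succ μ).ord, NonSplittingTriple K μ A (C α) (D α) b ∧ C α ≠ C (succ α) ∧
        ∀ k, EmbOn K (D (succ α)) N₁ k → (∀ z ∈ (C (succ α)).carrier, k z = e z) →
          Γ α ≠ graphOn k (D α).carrier := by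
  have hl := isSuccLimit_ord (hμ.trans (le_succ μ))
  let P := Model L × Model L × (ZFSet.{u} → ZFSet.{u})
  -- The non-splitting clause is required below `μ⁺` only, since the last models leave `K_μ`;
  -- containment in `W` and the embedding into `N₀` are kept at the top as well.
  let Q : Ordinal.{u} → (Ordinal.{u} → P) → P → Prop := fun α s x =>
    (α = 0 → x = (A, B, id)) ∧
    (∀ β < α, K.le (s β).1 x.1 ∧ K.le (s β).2.1 x.2.1 ∧
      ∀ z ∈ (s β).1.carrier, x.2.2 z = (s β).2.2 z) ∧
    (K.le x.1 x.2.1 ∧ x.2.1.carrier ⊆ W ∧ EmbOn K x.1 N₀ x.2.2) ∧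
    (α < (succ μ).ord → NonSplittingTriple K μ A x.1 x.2.1 b) ∧
    (∀ β, α = succ β → (s β).1 ≠ x.1 ∧ ∀ k, EmbOn K x.2.1 N₁ k →
      (∀ z ∈ x.1.carrier, k z = x.2.2 z) → Γ β ≠ graphOn k (s β).2.1.carrier) ∧
    (IsSuccLimit α → x.1.IsUnion (fun β => (s β).1) α ∧ x.2.1.IsUnion (fun β => (s β).2.1) α)
  have : Nonempty P := ⟨(A, B, id)⟩
  have hmono : ∀ {s : Ordinal.{u} → P} {β γ : Ordinal.{u}}, β ≤ γ → Q γ s (s γ) →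
      K.le (s β).1 (s γ).1 ∧ K.le (s β).2.1 (s γ).2.1 ∧
        ∀ z ∈ (s β).1.carrier, (s γ).2.2 z = (s β).2.2 z := by
    intro s β γ hβγ hγ
    rcases hβγ.eq_or_lt with rfl | h
    · exact ⟨K.refl (K.le_mem hγ.2.2.1.1).1, K.refl (K.le_mem hγ.2.2.1.1).2, fun _ _ => rfl⟩
    · exact hγ.2.1 β h
  obtain ⟨s, hs⟩ := exists_seq Q (succ μ).ord
    (by
      rintro α s t x hst ⟨h1, h2, h3, h4, h5, h6⟩
      refine ⟨h1, fun β hβ => hst β hβ ▸ h2 β hβ, h3, h4, ?_, fun hl => ?_⟩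
      · rintro β rfl
        exact hst β (lt_succ β) ▸ h5 β rfl
      · exact ⟨(h6 hl).1.congr fun β hβ => by rw [hst β hβ],
          (h6 hl).2.congr fun β hβ => by rw [hst β hβ]⟩)
    (by
      intro α hα s hs
      have hmono' : ∀ β γ, β ≤ γ → γ < α → K.le (s β).1 (s γ).1 ∧ K.le (s β).2.1 (s γ).2.1 ∧
          ∀ z ∈ (s β).1.carrier, (s γ).2.2 z = (s β).2.2 z := fun β γ h h' => hmono h (hs γ h')
      have hs0 : 0 < α → s 0 = (A, B, id) := fun h => (hs 0 h).1 rfl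
      rcases Ordinal.zero_or_succ_or_isSuccLimit α with rfl | ⟨β, rfl⟩ | hαl
      · exact ⟨(A, B, id), fun _ => rfl, fun β hβ => absurd hβ not_lt_bot,
          ⟨hAB.2.2.1, hBW, embOn_id hAN₀⟩, fun _ => hAB, fun β hβ => absurd hβ.symm (succ_ne_bot β),
          fun h => absurd h Ordinal.not_isSuccLimit_zero⟩
      · have hβ : β < succ β := lt_succ β
        have hβμ := hβ.trans_le hα
        have hsβ := hs β hβ
        have h0β := hmono' 0 β zero_le hβ
        rw [hs0 hβ.bot_lt] at h0β
        obtain ⟨C', D', e', hCC', hDD', hne, hnst, hD'W, he', hee', hk⟩ :=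
          (hsβ.2.2.2.1 hβμ).exists_extension (N₁ := N₁) hμ htrans h0β.1
            (huq _ _ h0β.1 h0β.2.1 (hsβ.2.2.2.1 hβμ)) hN₀ hsβ.2.2.1.2.2 hW hsβ.2.2.1.2.1 (Γ β)
        refine ⟨(C', D', e'), fun h => absurd h (succ_ne_bot β), fun γ hγ => ?_,
          ⟨hnst.2.2.1, hD'W, he'⟩, fun _ => hnst, fun γ hγ => ?_,
          fun h => absurd h (not_isSuccLimit_succ β)⟩
        · obtain ⟨h1, h2, h3⟩ := hmono' γ β (lt_succ_iff.1 hγ) hβ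
          exact ⟨K.trans h1 hCC', K.trans h2 hDD',
            fun z hz => (hee' z (le_subset h1 hz)).trans (h3 z hz)⟩
        · obtain rfl := succ_injective hγ
          exact ⟨hne, hk⟩
      · obtain ⟨U, hU⟩ := Model.exists_isUnion (fun β => (s β).1) hαl.bot_lt
          fun β γ h h' => K.isSubmodel (hmono' β γ h h').1
        obtain ⟨V, hV⟩ := Model.exists_isUnion (fun β => (s β).2.1) hαl.bot_lt
          fun β γ h h' => K.isSubmodel (hmono' β γ h h').2.1
        have hU' := K.union α _ U hαl.bot_lt (fun β γ h h' => (hmono' β γ h h').1) hU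
        have hV' := K.union α _ V hαl.bot_lt (fun β γ h h' => (hmono' β γ h h').2.1) hV
        have hXc : ∀ γ < α, IsSuccLimit γ → ((s γ).1).IsUnion (fun β => (s β).1) γ :=
          fun γ hγ hγl => ((hs γ hγ).2.2.2.2.2 hγl).1
        let f := glue (fun β => (s β).1.carrier) α fun β => (s β).2.2
        have hf : ∀ β < α, ∀ x ∈ (s β).1.carrier, f x = (s β).2.2 x := fun β hβ x hx =>
          glue_eq (S := fun β => (s β).1.carrier) (fun γ γ' h h' => (hmono' γ γ' h.le h').2.2) hβ hx
        have hUV : K.le U V ∧ EmbOn K U N₀ f := by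
          obtain ⟨Z, rfl, hZ, hZc⟩ := exists_isContChain hαl
            (fun β γ h h' => (hmono' β γ h h').1) hXc hU
          refine ⟨K.smooth α Z V hαl hZc fun β hβ => ?_, embOn_limit hαl hZc fun β hβ => ?_⟩
          · rw [hZ β hβ]
            exact K.trans (hs β hβ).2.2.1.1 (hV'.2 β hβ)
          · rw [hZ β hβ]
            exact (hs β hβ).2.2.1.2.2.congr fun x hx => (hf β hβ x hx).symm
        refine ⟨(U, V, f), fun h => absurd (h ▸ hαl) Ordinal.not_isSuccLimit_zero,
          fun β hβ => ⟨hU'.2 β hβ, hV'.2 β hβ, hf β hβ⟩, ⟨hUV.1, fun x hx => ?_, hUV.2⟩,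
          fun hαμ => ?_, fun β hβ => absurd (hβ ▸ hαl) (not_isSuccLimit_succ β), fun _ => ⟨hU, hV⟩⟩
        · obtain ⟨β, hβ, hx⟩ := hV.mem_iff.1 hx
          exact (hs β hβ).2.2.1.2.1 hx
        · have h0 : A = (s 0).1 := by rw [hs0 hαl.bot_lt]
          have := NonSplittingTriple.of_union (X := fun β => (s β).1) (Y := fun β => (s β).2.1)
            (b := b) hμ hcont hαl hαμ (fun β γ h h' => (hmono' β γ h h').1) hXc hU hV hV'.2 hUV.1
            (fun β hβ => h0 ▸ (hs β hβ).2.2.2.1 (hβ.trans hαμ))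
          exact h0.symm ▸ this)
  have htop := hs _ le_rfl
  refine ⟨fun α => (s α).1, fun α => (s α).2.1, (s (succ μ).ord).2.2,
    ⟨fun α β h h' => (hmono h (hs β h')).1, fun γ hγ hγl => ((hs γ hγ).2.2.2.2.2 hγl).1⟩,
    ⟨fun α β h h' => (hmono h (hs β h')).2.1, fun γ hγ hγl => ((hs γ hγ).2.2.2.2.2 hγl).2⟩,
    htop.2.2.1.1, htop.2.2.1.2.1, htop.2.2.1.2.2, fun α hα => ?_⟩
  have hα' := succ_le_of_lt hα
  obtain ⟨h1, h2⟩ := (hs _ hα').2.2.2.2.1 α rfl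
  refine ⟨(hs α hα.le).2.2.2.1 hα, h1, fun k hk hke => h2 k hk fun z hz => ?_⟩
  rw [hke z hz]
  exact (hmono hα' htop).2.2 z hz

/-- A function on the union of a chain is guessed correctly at some limit stage. -/
theorem exists_guess_graph (hμ : ℵ₀ ≤ μ) (h : Diamond (succ μ)) {W N : Set ZFSet.{u}}
    (hW : #W = Cardinal.lift.{u + 1} (succ μ)) (hN : #N = Cardinal.lift.{u + 1} (succ μ)) :
    ∃ Γ : Ordinal.{u} → Set (ZFSet.{u} × ZFSet.{u}), ∀ (D : Ordinal.{u} → Set ZFSet.{u})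
      (g : ZFSet.{u} → ZFSet.{u}), (∀ α β, α ≤ β → β < (succ μ).ord → D α ⊆ D β) →
      (∀ α < (succ μ).ord, #(D α) ≤ Cardinal.lift.{u + 1} μ) →
      (∀ δ < (succ μ).ord, IsSuccLimit δ → ∀ x ∈ D δ, ∃ α < δ, x ∈ D α) →
      (∀ α < (succ μ).ord, D α ⊆ W) → (∀ α < (succ μ).ord, Set.MapsTo g (D α) N) →
      ∃ δ < (succ μ).ord, Γ δ = graphOn g (D δ) := by
  classical
  have hs0 : ℵ₀ ≤ succ μ := hμ.trans (le_succ μ)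
  have hreg := Cardinal.isRegular_succ hμ
  obtain ⟨Δ, hΔ⟩ := h.exists_guess hμ
  have hcard : #(W × N) ≤ #(Set.Iio (succ μ).ord) := by
    rw [Cardinal.mk_Iio_ordinal, Cardinal.mk_prod, Cardinal.lift_id, Cardinal.lift_id, hW, hN,
      Cardinal.mul_eq_self (Cardinal.aleph0_le_lift.2 hs0), Cardinal.card_ord]
  -- Pairs in `W × N` are coded by ordinals below `μ⁺`, so that sets of ordinals guess sets of
  -- pairs.
  obtain ⟨c⟩ := hcard
  refine ⟨fun δ => {q | ∃ (h1 : q.1 ∈ W) (h2 : q.2 ∈ N),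
    (c (⟨q.1, h1⟩, ⟨q.2, h2⟩) : Ordinal.{u}) ∈ Δ δ}, fun D g hD hDc hDl hDW hg => ?_⟩
  let code : ZFSet.{u} → Ordinal.{u} := fun x =>
    if h : x ∈ W ∧ g x ∈ N then c (⟨x, h.1⟩, ⟨g x, h.2⟩) else 0
  have hcode : ∀ x (h1 : x ∈ W) (h2 : g x ∈ N), code x = c (⟨x, h1⟩, ⟨g x, h2⟩) :=
    fun x h1 h2 => dif_pos ⟨h1, h2⟩
  have hclt : ∀ x, code x < (succ μ).ord := fun x => by
    by_cases h : x ∈ W ∧ g x ∈ N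
    · rw [hcode x h.1 h.2]; exact (c _).2
    · simp only [code, dif_neg h]; exact zero_lt_ord hs0
  -- At a limit `δ` closed under such a `γ`, a point of the graph has code below `δ` exactly when
  -- its first coordinate is in `D δ`: codes `α < δ` come from points of `D γ`, and points of `D α`
  -- have codes at most `γ`. So the guess at `δ` is the graph on `D δ`.
  have hF : ∀ α, ∃ γ, α < (succ μ).ord → γ < (succ μ).ord ∧
      (∀ x β, β < (succ μ).ord → x ∈ D β → code x = α → x ∈ D γ) ∧
      ∀ x ∈ D α, code x ≤ γ := by
    intro α
    by_cases hα : α < (succ μ).ord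
    swap
    · exact ⟨0, fun h => absurd h hα⟩
    obtain ⟨γ₁, hγ₁, hγ₁'⟩ : ∃ γ < (succ μ).ord,
        ∀ x β, β < (succ μ).ord → x ∈ D β → code x = α → x ∈ D γ := by
      by_cases hex : ∃ x β, β < (succ μ).ord ∧ x ∈ D β ∧ code x = α
      · obtain ⟨x, β, hβ, hx, hxα⟩ := hex
        refine ⟨β, hβ, fun y β' hβ' hy hyα => ?_⟩
        have hy' := hyα.trans hxα.symm
        rw [hcode y (hDW _ hβ' hy) (hg _ hβ' hy), hcode x (hDW _ hβ hx) (hg _ hβ hx)] at hy'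
        have := c.injective (Subtype.ext hy')
        have : y = x := congrArg Subtype.val (Prod.ext_iff.1 this).1
        rwa [this]
      · exact ⟨0, zero_lt_ord hs0, fun x β hβ hx hxα => absurd ⟨x, β, hβ, hx, hxα⟩ hex⟩
    have hlt : sSup (code '' D α) < (succ μ).ord := by
      refine Ordinal.sSup_lt_of_lt_cof ?_ (by rintro _ ⟨x, -, rfl⟩; exact hclt x)
      rw [← Ordinal.lift_cof, hreg.cof_ord]
      have h1 : #(D α) < Cardinal.lift.{u + 1} (succ μ) :=
        (hDc α hα).trans_lt (Cardinal.lift_lt.2 (lt_succ μ))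
      exact Cardinal.mk_image_le.trans_lt h1
    have hbdd : BddAbove (code '' D α) := ⟨(succ μ).ord, by
      rintro _ ⟨x, -, rfl⟩; exact (hclt x).le⟩
    refine ⟨max γ₁ (sSup (code '' D α)), fun _ => ⟨max_lt hγ₁ hlt, fun x β hβ hx hxα => ?_,
      fun x hx => (le_csSup hbdd ⟨x, hx, rfl⟩).trans (le_max_right _ _)⟩⟩
    exact hD γ₁ _ (le_max_left _ _) (max_lt hγ₁ hlt) (hγ₁' x β hβ hx hxα)
  choose F hF using hF
  obtain ⟨δ, hδ, hδl, hδF, hδX⟩ := hΔ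
    {α | ∃ x β, β < (succ μ).ord ∧ x ∈ D β ∧ code x = α} F fun α hα => (hF α hα).1
  refine ⟨δ, hδ, ?_⟩
  ext ⟨x, y⟩
  constructor
  · rintro ⟨h1, h2, hq⟩
    rw [← hδX] at hq
    obtain ⟨⟨z, β, hβ, hz, hzc⟩, hlt⟩ := hq
    have hzc' := hzc
    rw [hcode z (hDW _ hβ hz) (hg _ hβ hz)] at hzc
    have := c.injective (Subtype.ext hzc)
    have hzx : z = x := congrArg Subtype.val (Prod.ext_iff.1 this).1
    have hzy : g z = y := congrArg Subtype.val (Prod.ext_iff.1 this).2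
    subst hzx hzy
    refine ⟨?_, rfl⟩
    have hmem := (hF _ (lt_trans (Set.mem_Iio.1 hlt) hδ)).2.1 z β hβ hz hzc'
    exact hD _ _ (hδF _ hlt).le hδ hmem
  · rintro ⟨hx, hy⟩
    obtain rfl : g x = y := hy
    have h1 := hDW δ hδ hx
    have h2 := hg δ hδ hx
    refine ⟨h1, h2, ?_⟩
    rw [← hδX]
    refine ⟨⟨x, δ, hδ, hx, hcode x h1 h2⟩, ?_⟩
    rw [Set.mem_Iio, ← hcode x h1 h2]
    obtain ⟨α, hα, hxα⟩ := hDl δ hδ hδl x hx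
    exact ((hF α (hα.trans hδ)).2.2 x hxα).trans_lt (hδF α hα)

theorem uniquenessTriplesDense (hLST : K.LST ≤ μ) (hdiamond : Diamond (succ μ))
    (htrans : (nonSplittingFrame K μ).Transitivity μ)
    (hcont : (nonSplittingFrame K μ).Continuity μ) (hAP : K.Amalgamation μ)
    (hNMM : K.NoMaximalModel μ) (hAP' : K.Amalgamation (succ μ)) (hst : K.Stable (succ μ)) :
    (nonSplittingFrame K μ).UniquenessTriplesDense μ := by
  rintro A B b ⟨hA, hB, -, hbA, hAB, hb, -⟩
  by_contra hno
  have hμ := aleph0_le_of_lst hLST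
  have hμs : K.LST ≤ succ μ := hLST.trans (le_succ μ)
  have hs0 : ℵ₀ ≤ succ μ := hμ.trans (le_succ μ)
  have hl := isSuccLimit_ord hs0
  have hlift : Cardinal.lift.{u + 1} μ ≤ Cardinal.lift.{u + 1} (succ μ) :=
    Cardinal.lift_le.2 (le_succ μ)
  have hABb : NonSplittingTriple K μ A A B b := ⟨hA, hB, hAB, hb,
    (nonForking_iff hAB hB _).2 ⟨hA, hA, K.refl hA.1, hbA, doesNotSplit_self hAB _⟩⟩
  obtain ⟨M, hM, hAM⟩ := exists_memCard_succ hμ hNMM hA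
  obtain ⟨N₀, hMN₀, hN₀, hsat⟩ := exists_saturated hLST hAP hAP' hst hM
  obtain ⟨N₁, hN₁, huniv⟩ := exists_universalOver hμs hAP' hst hN₀
  -- Any set of size `μ⁺` containing `B` would serve; `N₀` only supplies the cardinality.
  let W : Set ZFSet.{u} := B.carrier ∪ N₀.carrier
  have hW : #W = Cardinal.lift.{u + 1} (succ μ) := by
    refine le_antisymm ((Cardinal.mk_union_le _ _).trans ?_) ?_
    · exact Cardinal.add_le_of_le (Cardinal.aleph0_le_lift.2 hs0) (hB.2.le.trans hlift) hN₀.2.le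
    · rw [← hN₀.2]
      exact Cardinal.mk_le_mk_of_subset Set.subset_union_right
  obtain ⟨Γ, hΓ⟩ := exists_guess_graph hμ hdiamond hW hN₁.2
  obtain ⟨C, D, e, hC, hD, hCD, hDW, he, hstep⟩ := exists_defeating_chain (N₁ := N₁) hμ htrans hcont
    hABb (fun C D hAC hBD ⟨_, _, hCD, hb, hnf⟩ huq =>
      hno ⟨C, D, huq, hAC, hBD, hCD, hb, hnf⟩) hsat (K.trans hAM hMN₀)
    (hW ▸ Cardinal.lift_lt.2 (lt_succ μ)) Set.subset_union_left Γ
  -- `C` grows at every step and `D` stays inside `W`, so both unions have size exactly `μ⁺` and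
  -- amalgamation in `K_{μ⁺}` applies to them.
  have hDc : K.memCard (succ μ) (D (succ μ).ord) ∧ K.memCard (succ μ) (C (succ μ).ord) := by
    have h1 : Cardinal.lift.{u + 1} (succ μ) ≤ #(C (succ μ).ord).carrier := by
      have := lift_le_mk_of_strict (S := fun α => (C α).carrier) (U := (C (succ μ).ord).carrier)
        (fun α β h h' => le_subset (hC.mono α β h h'.le))
        (fun α hα => le_subset (IsContChain.le_last hC hα.le)) hl
        (fun α hα he => (hstep α hα).2.1
          (eq_of_le_of_subset (hC.mono α _ (le_succ α) (hl.succ_lt hα).le) he.superset))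
      simpa using this
    have h2 := mk_le_of_le hCD
    have h3 : #(D (succ μ).ord).carrier ≤ Cardinal.lift.{u + 1} (succ μ) :=
      (Cardinal.mk_le_mk_of_subset hDW).trans hW.le
    exact ⟨⟨(K.le_mem hCD).2, le_antisymm h3 (h1.trans h2)⟩,
      ⟨(K.le_mem hCD).1, le_antisymm (h2.trans h3) h1⟩⟩
  obtain ⟨g₀, hg₀⟩ := he
  -- The amalgam of `D` and `N₀` over `C` exists only after the construction, whereas the guesses
  -- need a target fixed beforehand; universality of `N₁` over `N₀` brings it there without moving
  -- the values of `e`.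
  obtain ⟨E, hE, fD, hEc, hfD⟩ := hAP'.exists_extension hDc.2 hDc.1 hN₀ (incl hCD) g₀
  obtain ⟨u, hu⟩ := huniv.2 E hEc hE
  obtain ⟨g, hg, hgu⟩ := (u.comp fD).exists_embOn
  have hge : ∀ z ∈ (C (succ μ).ord).carrier, g z = e z := fun z hz => by
    refine (hgu (incl hCD ⟨z, hz⟩)).trans ?_
    have h1 : fD (incl hCD ⟨z, hz⟩) = incl hE (g₀ ⟨z, hz⟩) := Subtype.ext (hfD ⟨z, hz⟩)
    rw [Emb.comp_apply, h1, ← hg₀ ⟨z, hz⟩]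
    exact hu _ _ (g₀ ⟨z, hz⟩).2
  obtain ⟨δ, hδ, hΓδ⟩ := hΓ (fun α => (D α).carrier) g
    (fun α β h h' => le_subset (hD.mono α β h h'.le))
    (fun α hα => (hstep α hα).1.2.1.2.le)
    (fun δ hδ hδl x hx => (hD.cont δ hδ.le hδl).mem_iff.1 hx)
    (fun α hα => (le_subset (IsContChain.le_last hD hα.le)).trans hDW)
    (fun α hα x hx => hg.map_mem (le_subset (IsContChain.le_last hD hα.le) hx))
  have hδ' := succ_le_of_lt hδ
  exact (hstep δ hδ).2.2 g (hg.of_le (IsContChain.le_last hD hδ'))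
    (fun z hz => hge z (le_subset (IsContChain.le_last hC hδ') hz)) hΓδ

end AEC

end AECFrame

theorem corollary13p3 {L : FirstOrder.Language.{u, u}} (K : AECFrame.AEC L) (μ : Cardinal.{u})
    (hLST : K.LST ≤ μ)
    (hne : ∃ A : AECFrame.Model L, K.memCard μ A)
    (hdiamond : AECFrame.Diamond (Order.succ μ))
    (htrans : (AECFrame.nonSplittingFrame K μ).Transitivity μ)
    (hcont : (AECFrame.nonSplittingFrame K μ).Continuity μ)
    (hAP : K.Amalgamation μ)
    (hNMM : K.NoMaximalModel μ)
    (hAP' : K.Amalgamation (Order.succ μ))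
    (hstab' : K.Stable (Order.succ μ)) :
    (AECFrame.nonSplittingFrame K μ).UniquenessTriplesDense μ :=
  AECFrame.AEC.uniquenessTriplesDense hLST hdiamond htrans hcont hAP hNMM hAP' hstab'
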